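/- Let $\mathcal L=d^4/dx^4$ be the operator in the real Hilbert space $L^2(0,1)$ with domain $H^4(0,1)\cap H^2_0(0,1)$ (so $\phi(0)=\phi'(0)=\phi(1)=\phi'(1)=0$ on the domain). Its eigenvalues are all positive and simple and form an increasing sequence $0<\lambda_1<\lambda_2<\cdots$; put $\Gamma=\sum_{i=1}^{\infty}\lambda_i^{-1}$. For an integer $N\ge 1$ let $h=1/N$, and let $l^2_{h,0}$ be the space of real grid functions $v=(v_0,\dots,v_N)$ with $v_0=v_N=0$. For $1\le j\le N-1$ set $$(\delta_x v)_j=\frac{v_{j+1}-v_{j-1}}{2h},\qquad (\delta_x^2 v)_j=\frac{v_{j+1}-2v_j+v_{j-1}}{h^2},\qquad (\sigma_x v)_j=\tfrac16v_{j-1}+\tfrac23v_j+\tfrac16v_{j+1},$$ all extended by $0$ to $j=0,N$. Let $v_x\in l^2_{h,0}$ be the Hermitian derivative of $v$, i.e. the unique element of $l^2_{h,0}$ with $\sigma_x v_x=\delta_x v$, and let $\delta_x^4:l^2_{h,0}\to l^2_{h,0}$ be the discrete biharmonic operator $$\delta_x^4 v=\frac{12}{h^2}\left[\delta_x v_x-\delta_x^2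 v\right].$$ Its eigenvalues, repeated according to multiplicity, are $N-1$ positive real numbers $0<\lambda_{h,1}\le\dots\le\lambda_{h,N-1}$; put $\Gamma_h=\sum_{i=1}^{N-1}\lambda_{h,i}^{-1}$. Then the series $\Gamma$ converges, there is a constant $C>0$, independent of $h$, such that $$|\Gamma-\Gamma_h|\le C h^4\qquad\text{for all } h=1/N,\ N\ge 1,$$ and explicitly $$\Gamma=\frac1{420},\qquad \Gamma_h=\frac1{420}+\frac{h^4}{180}-\frac{h^6}{126}.$$ -/

import Mathlib

open Set MeasureTheory Polynomial
open scoped ContDiff ENNReal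

noncomputable section

namespace SplineEigen

/-! ### The continuous operator `d⁴/dx⁴` on `(0,1)` with clamped boundary conditions -/

/-- The real Hilbert space `L²(0,1)`. -/
abbrev L2I : Type := Lp ℝ 2 (volume.restrict (Ioo (0 : ℝ) 1))

/-- Test functions on `(0,1)`: smooth with compact support contained in `(0,1)`. -/
def IsTest (φ : ℝ → ℝ) : Prop :=
  ContDiff ℝ ∞ φ ∧ HasCompactSupport φ ∧ tsupport φ ⊆ Ioo (0 : ℝ) 1

/-- `w ∈ L²(0,1)` is the weak (distributional) derivative of order `k` of `u ∈ L²(0,1)`. -/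
def IsWeakDeriv (k : ℕ) (u w : L2I) : Prop :=
  ∀ φ : ℝ → ℝ, IsTest φ →
    ∫ x in Ioo (0 : ℝ) 1, u x * iteratedDeriv k φ x
      = (-1) ^ k * ∫ x in Ioo (0 : ℝ) 1, w x * φ x

theorem IsTest.integrable {φ : ℝ → ℝ} (hφ : IsTest φ) (k : ℕ) (u : L2I) :
    Integrable (fun x => u x * iteratedDeriv k φ x) (volume.restrict (Ioo (0 : ℝ) 1)) := by
  have hc : Continuous (iteratedDeriv k φ) :=
    hφ.1.continuous_iteratedDeriv k (by exact_mod_cast le_top)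
  have hs : HasCompactSupport (iteratedDeriv k φ) := by
    rw [iteratedDeriv_eq_iterate]
    clear hc
    induction k with
    | zero => simpa using hφ.2.1
    | succ n ih => rw [Function.iterate_succ_apply']; exact ih.deriv
  have hm : MemLp (iteratedDeriv k φ) 2 (volume.restrict (Ioo (0 : ℝ) 1)) :=
    (hc.memLp_of_hasCompactSupport hs).restrict _
  exact (Lp.memLp u).integrable_mul hm

theorem IsTest.integrable_zero {φ : ℝ → ℝ} (hφ : IsTest φ) (u : L2I) :
    Integrable (fun x => u x * φ x) (volume.restrict (Ioo (0 : ℝ) 1)) := by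
  simpa using hφ.integrable 0 u

theorem IsWeakDeriv.add {k : ℕ} {u u' w w' : L2I} (h : IsWeakDeriv k u w)
    (h' : IsWeakDeriv k u' w') : IsWeakDeriv k (u + u') (w + w') := by
  intro φ hφ
  have e1 : ∫ x in Ioo (0 : ℝ) 1, (u + u' : L2I) x * iteratedDeriv k φ x
      = ∫ x in Ioo (0 : ℝ) 1, (u x * iteratedDeriv k φ x + u' x * iteratedDeriv k φ x) := by
    refine integral_congr_ae ?_
    filter_upwards [Lp.coeFn_add u u'] with x hx
    rw [hx, Pi.add_apply, add_mul]
  have e2 : ∫ x in Ioo (0 : ℝ) 1, (w + w' : L2I) x * φ x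
      = ∫ x in Ioo (0 : ℝ) 1, (w x * φ x + w' x * φ x) := by
    refine integral_congr_ae ?_
    filter_upwards [Lp.coeFn_add w w'] with x hx
    rw [hx, Pi.add_apply, add_mul]
  rw [e1, e2, integral_add (hφ.integrable k u) (hφ.integrable k u'),
    integral_add (hφ.integrable_zero w) (hφ.integrable_zero w'), h φ hφ, h' φ hφ, mul_add]

theorem IsWeakDeriv.smul {k : ℕ} {u w : L2I} (c : ℝ) (h : IsWeakDeriv k u w) :
    IsWeakDeriv k (c • u) (c • w) := by
  intro φ hφ
  have e1 : ∫ x in Ioo (0 : ℝ) 1, (c • u : L2I) x * iteratedDeriv k φ x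
      = ∫ x in Ioo (0 : ℝ) 1, c * (u x * iteratedDeriv k φ x) := by
    refine integral_congr_ae ?_
    filter_upwards [Lp.coeFn_smul c u] with x hx
    rw [hx, Pi.smul_apply, smul_eq_mul, mul_assoc]
  have e2 : ∫ x in Ioo (0 : ℝ) 1, (c • w : L2I) x * φ x
      = ∫ x in Ioo (0 : ℝ) 1, c * (w x * φ x) := by
    refine integral_congr_ae ?_
    filter_upwards [Lp.coeFn_smul c w] with x hx
    rw [hx, Pi.smul_apply, smul_eq_mul, mul_assoc]
  rw [e1, e2, integral_const_mul, integral_const_mul, h φ hφ]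
  ring

theorem IsWeakDeriv.zero (k : ℕ) : IsWeakDeriv k 0 0 := by
  intro φ hφ
  have e : ∀ g : ℝ → ℝ, ∫ x in Ioo (0 : ℝ) 1, (0 : L2I) x * g x = 0 := by
    intro g
    refine integral_eq_zero_of_ae ?_
    filter_upwards [Lp.coeFn_zero ℝ 2 (volume.restrict (Ioo (0 : ℝ) 1))] with x hx
    rw [hx]; simp
  rw [e, e, mul_zero]

theorem IsWeakDeriv.unique {k : ℕ} {u w w' : L2I} (h : IsWeakDeriv k u w)
    (h' : IsWeakDeriv k u w') : w = w' := by
  have key : ∀ φ, IsTest φ →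
      ∫ x in Ioo (0 : ℝ) 1, w x * φ x = ∫ x in Ioo (0 : ℝ) 1, w' x * φ x := by
    intro φ hφ
    have := (h φ hφ).symm.trans (h' φ hφ)
    exact mul_left_cancel₀ (pow_ne_zero k (by norm_num)) this
  have hi : IntegrableOn (fun x => w x - w' x) (Ioo (0 : ℝ) 1) :=
    ((Lp.memLp w).integrable (by norm_num)).sub ((Lp.memLp w').integrable (by norm_num))
  have hz := isOpen_Ioo.ae_eq_zero_of_integral_contDiff_smul_eq_zero hi.locallyIntegrableOn
    (by
      intro g hg hgc hgs
      have hgt : IsTest g := ⟨hg, hgc, hgs⟩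
      rw [← setIntegral_eq_integral_of_forall_compl_eq_zero (s := Ioo (0 : ℝ) 1)]
      · have := key g hgt
        calc ∫ x in Ioo (0 : ℝ) 1, g x • (w x - w' x)
            = ∫ x in Ioo (0 : ℝ) 1, (w x * g x - w' x * g x) := by
              congr 1; ext x; simp only [smul_eq_mul]; ring
          _ = 0 := by
              rw [integral_sub (hgt.integrable_zero w) (hgt.integrable_zero w'), this, sub_self]
      · intro x hx
        have : g x = 0 := image_eq_zero_of_notMem_tsupport fun hx' => hx (hgs hx')
        simp [this])
  apply Lp.ext
  rw [Filter.EventuallyEq, ae_restrict_iff' measurableSet_Ioo]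
  filter_upwards [hz] with x hx hxI
  exact sub_eq_zero.1 (hx hxI)

/-- The Sobolev space `Hᵐ(0,1)`: weak derivatives up to order `m` exist in `L²(0,1)`. -/
def sobolevH (m : ℕ) : Submodule ℝ L2I where
  carrier := {u | ∀ k ≤ m, ∃ w : L2I, IsWeakDeriv k u w}
  add_mem' := fun {_ _} hu hv k hk => by
    obtain ⟨w, hw⟩ := hu k hk
    obtain ⟨w', hw'⟩ := hv k hk
    exact ⟨w + w', hw.add hw'⟩
  zero_mem' := fun k _ => ⟨0, IsWeakDeriv.zero k⟩
  smul_mem' := fun c _ hu k hk => by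
    obtain ⟨w, hw⟩ := hu k hk
    exact ⟨c • w, hw.smul c⟩

/-- `H²₀(0,1)`: the functions in `H²(0,1)` whose (`C¹`) representative vanishes, together with
its first derivative, at both endpoints. -/
def sobolevH20 : Submodule ℝ L2I where
  carrier := {u | u ∈ sobolevH 2 ∧ ∃ U : ℝ → ℝ, ContDiff ℝ 1 U ∧
    (u =ᵐ[volume.restrict (Ioo (0 : ℝ) 1)] U) ∧
    U 0 = 0 ∧ deriv U 0 = 0 ∧ U 1 = 0 ∧ deriv U 1 = 0}
  add_mem' := by
    rintro u v ⟨hu, U, hU, huU, a, b, c, d⟩ ⟨hv, V, hV, hvV, a', b', c', d'⟩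
    refine ⟨add_mem hu hv, U + V, hU.add hV, (Lp.coeFn_add u v).trans (huU.add hvV), ?_⟩
    have hd : ∀ x, deriv (U + V) x = deriv U x + deriv V x := fun x =>
      deriv_add (hU.differentiable one_ne_zero x) (hV.differentiable one_ne_zero x)
    simp [hd, a, b, c, d, a', b', c', d']
  zero_mem' := by
    refine ⟨zero_mem _, 0, contDiff_const, Lp.coeFn_zero _ _ _, ?_⟩
    have hd : ∀ x, deriv (0 : ℝ → ℝ) x = 0 := fun x => deriv_const x 0
    simp [hd]
  smul_mem' := by
    rintro r u ⟨hu, U, hU, huU, a, b, c, d⟩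
    refine ⟨Submodule.smul_mem _ r hu, r • U, hU.const_smul r,
      (Lp.coeFn_smul r u).trans (huU.const_smul r), ?_⟩
    have hd : ∀ x, deriv (r • U) x = r • deriv U x := fun x =>
      deriv_const_smul r (hU.differentiable one_ne_zero x)
    simp [hd, a, b, c, d]

/-- The operator `𝓛 = d⁴/dx⁴` in `L²(0,1)` with domain `H⁴(0,1) ∩ H²₀(0,1)`. -/
def biharmonic : L2I →ₗ.[ℝ] L2I where
  domain := sobolevH 4 ⊓ sobolevH20
  toFun :=
    { toFun := fun u => (u.2.1 4 le_rfl).choose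
      map_add' := fun u v => IsWeakDeriv.unique ((u + v).2.1 4 le_rfl).choose_spec
        ((u.2.1 4 le_rfl).choose_spec.add (v.2.1 4 le_rfl).choose_spec)
      map_smul' := fun c u => IsWeakDeriv.unique ((c • u).2.1 4 le_rfl).choose_spec
        ((u.2.1 4 le_rfl).choose_spec.smul c) }

/-- `𝓛 u` is the weak fourth derivative of `u`. -/
theorem biharmonic_spec (u : biharmonic.domain) : IsWeakDeriv 4 (u : L2I) (biharmonic u) :=
  (u.2.1 4 le_rfl).choose_spec

/-- The eigenspace `{u ∈ D(𝓛) | 𝓛 u = μ u}`. -/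
def eigenspace (μ : ℝ) : Submodule ℝ biharmonic.domain :=
  LinearMap.ker (biharmonic.toFun - μ • biharmonic.domain.subtype)

/-- `lam 0 < lam 1 < …` is the increasing sequence of all eigenvalues of `𝓛`
(`lam i` is `λ_{i+1}`); they are positive and simple. -/
structure IsEigenvalueSeq (lam : ℕ → ℝ) : Prop where
  strictMono : StrictMono lam
  range_eq : Set.range lam = {μ | eigenspace μ ≠ ⊥}
  pos : ∀ i, 0 < lam i
  simple : ∀ i, Module.finrank ℝ (eigenspace (lam i)) = 1

/-! ### The discrete operator -/

/-- The space `l²_{h,0}` of grid functions on `{x_0, …, x_N}`, `x_j = j / N`, vanishing at the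
endpoints. -/
def gridSpace (N : ℕ) : Submodule ℝ (Fin (N + 1) → ℝ) where
  carrier := {v | v 0 = 0 ∧ v (Fin.last N) = 0}
  add_mem' := by rintro u v ⟨a, b⟩ ⟨c, d⟩; simp [a, b, c, d]
  zero_mem' := by simp
  smul_mem' := by rintro r u ⟨a, b⟩; simp [a, b]

/-- The three-point operator `v ↦ (a v_{j-1} + b v_j + c v_{j+1})` at the interior nodes
`1 ≤ j ≤ N - 1`, with value `0` at the endpoints. -/
def stencil (N : ℕ) (a b c : ℝ) : gridSpace N →ₗ[ℝ] gridSpace N where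
  toFun v := ⟨fun j => if hj : 0 < j.val ∧ j.val < N then
      a * v.1 ⟨j.val - 1, by omega⟩ + b * v.1 j + c * v.1 ⟨j.val + 1, by omega⟩ else 0,
    by constructor <;> simp⟩
  map_add' u v := by
    ext j
    by_cases hj : 0 < j.val ∧ j.val < N
    · simp only [Submodule.coe_add, Pi.add_apply, dif_pos hj]; ring
    · simp only [Submodule.coe_add, Pi.add_apply, dif_neg hj, add_zero]
  map_smul' r u := by
    ext j
    by_cases hj : 0 < j.val ∧ j.val < N
    · simp only [Submodule.coe_smul, Pi.smul_apply, dif_pos hj, smul_eq_mul, RingHom.id_apply]; ring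
    · simp only [Submodule.coe_smul, Pi.smul_apply, dif_neg hj, smul_zero]

/-- The mesh size `h = 1 / N`. -/
def mesh (N : ℕ) : ℝ := 1 / (N : ℝ)

/-- `(δ_x v)_j = (v_{j+1} - v_{j-1}) / (2h)`. -/
def delta (N : ℕ) : gridSpace N →ₗ[ℝ] gridSpace N :=
  (1 / (2 * mesh N)) • stencil N (-1) 0 1

/-- `(δ_x² v)_j = (v_{j+1} - 2 v_j + v_{j-1}) / h²`. -/
def deltaSq (N : ℕ) : gridSpace N →ₗ[ℝ] gridSpace N :=
  (1 / mesh N ^ 2) • stencil N 1 (-2) 1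

/-- The Simpson operator `(σ_x v)_j = v_{j-1} / 6 + 2 v_j / 3 + v_{j+1} / 6`. -/
def simpson (N : ℕ) : gridSpace N →ₗ[ℝ] gridSpace N :=
  stencil N (1 / 6) (2 / 3) (1 / 6)

theorem simpson_injective (N : ℕ) : Function.Injective (simpson N) := by
  rw [← LinearMap.ker_eq_bot, LinearMap.ker_eq_bot']
  intro v hv
  obtain ⟨j, hj⟩ := Finite.exists_max fun j : Fin (N + 1) => |v.1 j|
  have hj0 : v.1 j = 0 := by
    by_cases hI : 0 < j.val ∧ j.val < N
    · have h1 : (simpson N v).1 j = 0 := by rw [hv]; rfl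
      have h2 : (1 / 6 : ℝ) * v.1 ⟨j.val - 1, by omega⟩ + 2 / 3 * v.1 j
          + 1 / 6 * v.1 ⟨j.val + 1, by omega⟩ = 0 := by
        have h2' := h1
        simp only [simpson, stencil, LinearMap.coe_mk, AddHom.coe_mk, dif_pos hI] at h2'
        exact h2'
      have h3 := hj ⟨j.val - 1, by omega⟩
      have h4 := hj ⟨j.val + 1, by omega⟩
      rw [← abs_nonpos_iff]
      have e : 2 / 3 * v.1 j = -(1 / 6 * v.1 ⟨j.val - 1, by omega⟩)
          - 1 / 6 * v.1 ⟨j.val + 1, by omega⟩ := by linarith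
      rcases abs_cases (v.1 j) with h | h <;>
        linarith [neg_abs_le (v.1 ⟨j.val - 1, by omega⟩), le_abs_self (v.1 ⟨j.val - 1, by omega⟩),
          neg_abs_le (v.1 ⟨j.val + 1, by omega⟩), le_abs_self (v.1 ⟨j.val + 1, by omega⟩)]
    · have : j = 0 ∨ j = Fin.last N := by
        rw [Fin.ext_iff, Fin.ext_iff]; simp only [Fin.val_zero, Fin.val_last]; omega
      rcases this with h | h
      · rw [h]; exact v.2.1
      · rw [h]; exact v.2.2
  ext i
  have := hj i
  simp only [hj0, abs_zero] at this
  simpa using this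

/-- The Hermitian derivative `v ↦ v_x`: the unique `v_x ∈ l²_{h,0}` with `σ_x v_x = δ_x v`. -/
def hermitian (N : ℕ) : gridSpace N →ₗ[ℝ] gridSpace N :=
  (LinearEquiv.ofInjectiveEndo (simpson N) (simpson_injective N)).symm.toLinearMap ∘ₗ delta N

theorem simpson_hermitian (N : ℕ) (v : gridSpace N) :
    simpson N (hermitian N v) = delta N v :=
  LinearEquiv.apply_symm_apply
    (LinearEquiv.ofInjectiveEndo (simpson N) (simpson_injective N)) (delta N v)

/-- The discrete biharmonic operator `δ_x⁴ v = (12 / h²) (δ_x v_x - δ_x² v)` on `l²_{h,0}`. -/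
def discreteBiharmonic (N : ℕ) : gridSpace N →ₗ[ℝ] gridSpace N :=
  (12 / mesh N ^ 2) • (delta N ∘ₗ hermitian N - deltaSq N)

/-- `0 < mu 0 ≤ mu 1 ≤ …` is the list of the `N - 1` eigenvalues of `δ_x⁴`, repeated according to
multiplicity (`mu i` is `λ_{h,i+1}`). -/
structure IsDiscreteEigenvalueSeq (N : ℕ) (mu : Fin (N - 1) → ℝ) : Prop where
  monotone : Monotone mu
  charpoly_eq : (discreteBiharmonic N).charpoly = ∏ i, (X - C (mu i))
  pos : ∀ i, 0 < mu i

end SplineEigen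

end

/-! Both sums are traces of inverse operators, and both inverses come from one Green function `G(x,
y)`.

Continuous side. Let `V` be integration from `0` and `P` the projection off the affine functions.
The left clamping conditions make every `u` in the domain equal to `V² u''`, and the right ones say
that `u''` is orthogonal to affine functions. Since `(V²)*` also undoes two derivatives, the inverse
of the operator is `V² P (V²)*` (`biharmonic_green`, `green_biharmonic`). With `A = V² P` this is `A
A*`, so its trace is the Hilbert–Schmidt norm squared of `A`. The kernel of `A` is `K_x = P (x -
·)₊`, where `⟨K_x, K_y⟩ = G(x, y)` and `‖K_x‖² = x³(1-x)³/3`; integrating gives `1/420`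
(`hasSum_inner_green`). The Green operator is compact, symmetric and injective, and the eigenvalues
are simple by an ODE argument (`IsClampedSol.eq_zero`), so there is an eigenbasis indexed by the
eigenvalues. The trace in that basis is the sum of their inverses.

Discrete side. As a function of `x`, `G(x, y)` is a cubic spline with a knot at `y`. When `y` is a
node, Hermitian derivatives of such splines are exact, and the discrete biharmonic operator reads
off the jump of the third derivative. Hence the inverse of its matrix is exactly `h G(x_i, x_j)`
(`biharmonicMatrix_mul_greenMatrix`), a Gram matrix.

The discrete sum is therefore the trapezoidal rule for the integral giving the continuous one. Its
integrand vanishes to third order at both ends, so the Euler–Maclaurin error starts at `h⁴`; here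
the sum is evaluated in closed form (`trace_greenMatrix`). -/

noncomputable section

namespace SplineEigen

/-! ### Hilbert–Schmidt operators -/

section HilbertSchmidt

variable {ι H : Type*} [NormedAddCommGroup H] [InnerProductSpace ℝ H]

/-- Cauchy–Schwarz followed by Bessel. With `v i = A (b i)` it bounds the operator norm of a finite
block of `A` by its Hilbert–Schmidt sum. -/
theorem norm_sq_sum_smul_le {b : ι → H} (hb : Orthonormal ℝ b) (v : ι → H) (t : Finset ι) (f : H) :
    ‖∑ i ∈ t, inner ℝ (b i) f • v i‖ ^ 2 ≤ (∑ i ∈ t, ‖v i‖ ^ 2) * ‖f‖ ^ 2 := by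
  have h1 : ‖∑ i ∈ t, inner ℝ (b i) f • v i‖ ≤ ∑ i ∈ t, ‖v i‖ * ‖inner ℝ (b i) f‖ := by
    refine (norm_sum_le _ _).trans (Finset.sum_le_sum fun i _ => ?_)
    rw [norm_smul, mul_comm]
  have h2 := Finset.sum_mul_sq_le_sq_mul_sq t (fun i => ‖v i‖) (fun i => ‖inner ℝ (b i) f‖)
  have h3 : ∑ i ∈ t, ‖inner ℝ (b i) f‖ ^ 2 ≤ ‖f‖ ^ 2 := hb.sum_inner_products_le f
  calc ‖∑ i ∈ t, inner ℝ (b i) f • v i‖ ^ 2 ≤ (∑ i ∈ t, ‖v i‖ * ‖inner ℝ (b i) f‖) ^ 2 := by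
        gcongr
    _ ≤ _ := h2
    _ ≤ _ := by
        gcongr

/-- An operator with `∑ ‖A bᵢ‖² < ∞` for a Hilbert basis `b` is compact. -/
theorem isCompactOperator_of_summable_norm_sq [CompleteSpace H] (b : HilbertBasis ι ℝ H)
    (A : H →L[ℝ] H) (hA : Summable fun i => ‖A (b i)‖ ^ 2) : IsCompactOperator A := by
  let R : ι → H →L[ℝ] H := fun i => InnerProductSpace.rankOne ℝ (A (b i)) (b i)
  have hRapp : ∀ (t : Finset ι) (f : H),
      (∑ i ∈ t, R i) f = ∑ i ∈ t, inner ℝ (b i) f • A (b i) := by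
    intro t f
    simp [R]
  have hnorm : ∀ t : Finset ι, ‖∑ i ∈ t, R i‖ ≤ Real.sqrt (∑ i ∈ t, ‖A (b i)‖ ^ 2) := by
    intro t
    refine ContinuousLinearMap.opNorm_le_bound _ (Real.sqrt_nonneg _) fun f => ?_
    rw [hRapp, ← Real.sqrt_sq (norm_nonneg f), ← Real.sqrt_mul (Finset.sum_nonneg fun i _ => by
      positivity)]
    exact Real.le_sqrt_of_sq_le (norm_sq_sum_smul_le b.orthonormal _ t f)
  -- The block bound turns the Cauchy criterion for `∑ ‖A bᵢ‖²` into one in operator norm, so `A` is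
  -- a norm limit of finite-rank operators.
  have hs : Summable R := by
    rw [summable_iff_vanishing_norm]
    intro ε hε
    obtain ⟨s, hs⟩ := summable_iff_vanishing_norm.1 hA (ε ^ 2) (by positivity)
    refine ⟨s, fun t ht => (hnorm t).trans_lt ?_⟩
    rw [Real.sqrt_lt' hε]
    exact (le_abs_self _).trans_lt (hs t ht)
  have hsum : HasSum R A := by
    have h := hs.hasSum
    convert h using 1
    ext f
    have h1 : HasSum (fun i => R i f) ((∑' i, R i) f) := by
      simpa using (ContinuousLinearMap.apply ℝ H f).hasSum h
    have h2 : HasSum (fun i => R i f) (A f) := by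
      have h3 := A.hasSum (b.hasSum_repr f)
      simpa [R, b.repr_apply_apply] using! h3
    exact h2.unique h1
  refine isCompactOperator_of_tendsto hsum (Filter.Eventually.of_forall fun t => ?_)
  have : ∀ i, IsCompactOperator (R i) := by
    intro i
    exact (isCompactOperator_of_locallyCompactSpace_rng
      (ContinuousLinearMap.toSpanSingleton ℝ (A (b i)))).comp_clm (innerSL ℝ (b i))
  have : ∑ i ∈ t, R i ∈ compactOperator (RingHom.id ℝ) H H :=
    Submodule.sum_mem _ fun i _ => this i
  exact this

theorem hasSum_inner_sq (b : HilbertBasis ι ℝ H) (x : H) :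
    HasSum (fun i => inner ℝ x (b i) ^ 2) (‖x‖ ^ 2) := by
  have := b.hasSum_inner_mul_inner x x
  rw [real_inner_self_eq_norm_sq] at this
  simpa only [sq, real_inner_comm x] using this

/-- Parseval in `[0, ∞]`, so that later interchanges of sums and integrals need no summability
check. -/
theorem tsum_enorm_inner_sq (b : HilbertBasis ι ℝ H) (x : H) :
    ∑' i, ‖inner ℝ x (b i)‖ₑ ^ 2 = ‖x‖ₑ ^ 2 := by
  have h := hasSum_inner_sq b x
  have : ∀ i, ‖inner ℝ x (b i)‖ₑ ^ 2 = ENNReal.ofReal (inner ℝ x (b i) ^ 2) := by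
    intro i
    rw [Real.enorm_eq_ofReal_abs, ← ENNReal.ofReal_pow (abs_nonneg _), sq_abs]
  simp_rw [this]
  rw [← ENNReal.ofReal_tsum_of_nonneg (fun i => sq_nonneg _) h.summable, h.tsum_eq,
    ENNReal.ofReal_pow (norm_nonneg _), ofReal_norm]

/-- The Hilbert–Schmidt sum of an operator and of its adjoint agree. -/
theorem tsum_enorm_adjoint_sq [CompleteSpace H] (b : HilbertBasis ι ℝ H) (A : H →L[ℝ] H) :
    ∑' i, ‖A.adjoint (b i)‖ₑ ^ 2 = ∑' i, ‖A (b i)‖ₑ ^ 2 := by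
  -- By Parseval both sides become the double sum of the squared matrix entries, in the two orders
  -- of summation.
  simp_rw [← tsum_enorm_inner_sq b]
  rw [ENNReal.tsum_comm]
  simp_rw [ContinuousLinearMap.adjoint_inner_left, real_inner_comm]

variable {α : Type*} [MeasurableSpace α] {μ : Measure α}

theorem enorm_sq_eq_lintegral (f : Lp ℝ 2 μ) : ‖f‖ₑ ^ 2 = ∫⁻ x, ‖f x‖ₑ ^ 2 ∂μ := by
  have := eLpNorm_nnreal_pow_eq_lintegral (f := f) (μ := μ) (p := 2) (by norm_num)
  rw [Lp.enorm_def]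
  simpa using this

/-- The Hilbert–Schmidt sum of an integral operator is the squared norm of its kernel. -/
theorem tsum_enorm_sq_eq_lintegral [Countable ι] (b : HilbertBasis ι ℝ (Lp ℝ 2 μ))
    {A : Lp ℝ 2 μ →L[ℝ] Lp ℝ 2 μ} {K : α → Lp ℝ 2 μ}
    (hA : ∀ u, A u =ᵐ[μ] fun x => inner ℝ (K x) u) :
    ∑' i, ‖A (b i)‖ₑ ^ 2 = ∫⁻ x, ‖K x‖ₑ ^ 2 ∂μ := by
  simp_rw [enorm_sq_eq_lintegral (A _)]
  rw [← lintegral_tsum fun i => ((Lp.aestronglyMeasurable _).enorm.pow_const 2)]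
  refine lintegral_congr_ae ?_
  filter_upwards [ae_all_iff.2 fun i => hA (b i)] with x hx
  simp_rw [hx]
  exact tsum_enorm_inner_sq b (K x)

end HilbertSchmidt

/-! ### Primitives and the Volterra operator -/

/-- Lebesgue measure on the unit interval. -/
abbrev unitVol : Measure ℝ := volume.restrict (Ioo (0 : ℝ) 1)

instance : IsProbabilityMeasure unitVol := ⟨by simp⟩

/-- The primitive vanishing at `0`. -/
def prim (f : ℝ → ℝ) (x : ℝ) : ℝ := ∫ t in (0 : ℝ)..x, f t

/-- Extension by zero of an element of `L²(0,1)`. -/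
def extZero (u : L2I) : ℝ → ℝ := (Ioo (0 : ℝ) 1).indicator u

/-- The class in `L²(0,1)` of a function, `0` if the function is not square integrable. -/
def toL2 (f : ℝ → ℝ) : L2I := by
  classical exact if h : MemLp f 2 unitVol then h.toLp f else 0

theorem memLp_of_continuous {f : ℝ → ℝ} (hf : Continuous f) : MemLp f 2 unitVol := by
  obtain ⟨C, hC⟩ := (isCompact_Icc (a := (0 : ℝ)) (b := 1)).exists_bound_of_continuousOn
    hf.continuousOn
  refine MemLp.of_bound hf.aestronglyMeasurable C ?_
  filter_upwards [ae_restrict_mem measurableSet_Ioo] with x hx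
  exact hC x (Ioo_subset_Icc_self hx)

theorem toL2_ae {f : ℝ → ℝ} (hf : Continuous f) : toL2 f =ᵐ[unitVol] f := by
  rw [toL2, dif_pos (memLp_of_continuous hf)]
  exact MemLp.coeFn_toLp _

theorem extZero_ae (u : L2I) : extZero u =ᵐ[unitVol] u :=
  indicator_ae_eq_restrict measurableSet_Ioo

theorem integrable_extZero (u : L2I) : Integrable (extZero u) := by
  rw [extZero, integrable_indicator_iff measurableSet_Ioo]
  exact (Lp.memLp u).integrable (by norm_num)

theorem integral_Ioo_eq (f : ℝ → ℝ) : ∫ x in Ioo (0 : ℝ) 1, f x = ∫ x in (0 : ℝ)..1, f x := by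
  rw [intervalIntegral.integral_of_le zero_le_one, integral_Ioc_eq_integral_Ioo]

theorem inner_eq_integral (u v : L2I) : inner ℝ u v = ∫ x in Ioo (0 : ℝ) 1, u x * v x := by
  rw [L2.inner_def]
  simp [mul_comm]

theorem inner_toL2 (u : L2I) {f : ℝ → ℝ} (hf : Continuous f) :
    inner ℝ u (toL2 f) = ∫ x in Ioo (0 : ℝ) 1, u x * f x := by
  rw [inner_eq_integral]
  refine integral_congr_ae ?_
  filter_upwards [toL2_ae hf] with x hx
  rw [hx]

theorem continuous_prim {f : ℝ → ℝ} (hf : Integrable f) : Continuous (prim f) :=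
  intervalIntegral.continuous_primitive (fun _ _ => hf.intervalIntegrable) 0

theorem continuous_prim_of_continuous {f : ℝ → ℝ} (hf : Continuous f) : Continuous (prim f) :=
  intervalIntegral.continuous_primitive (fun _ _ => hf.intervalIntegrable _ _) 0

theorem hasDerivAt_prim {f : ℝ → ℝ} (hf : Continuous f) (x : ℝ) : HasDerivAt (prim f) (f x) x :=
  (hf.integral_hasStrictDerivAt 0 x).hasDerivAt

@[simp] theorem prim_zero (f : ℝ → ℝ) : prim f 0 = 0 := by simp [prim]

theorem prim_congr {f g : ℝ → ℝ} (h : f =ᵐ[unitVol] g) {x : ℝ} (hx : x ∈ Icc (0 : ℝ) 1) :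
    prim f x = prim g x := by
  rw [prim, prim, intervalIntegral.integral_of_le hx.1, intervalIntegral.integral_of_le hx.1,
    integral_Ioc_eq_integral_Ioo, integral_Ioc_eq_integral_Ioo]
  exact integral_congr_ae (ae_mono (Measure.restrict_mono (Ioo_subset_Ioo_right hx.2) le_rfl) h)

/-- Integration by parts against a primitive. -/
theorem integral_prim_mul_deriv {f g g' : ℝ → ℝ} (hf : Integrable f) (hg : ∀ x, HasDerivAt g (g' x) x)
    (hg' : Continuous g') (x : ℝ) :
    ∫ t in (0 : ℝ)..x, prim f t * g' t = prim f x * g x - ∫ t in (0 : ℝ)..x, f t * g t := by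
  have hd : deriv g = g' := funext fun x => (hg x).deriv
  have hgc : ContDiff ℝ 1 g := contDiff_one_iff_deriv.2
    ⟨fun x => (hg x).differentiableAt, hd ▸ hg'⟩
  have hfi : IntervalIntegrable f volume 0 x := hf.intervalIntegrable
  -- `f` is only integrable, so its primitive is merely absolutely continuous and differentiable
  -- almost everywhere.
  have h1 : AbsolutelyContinuousOnInterval (prim f) 0 x :=
    hfi.absolutelyContinuousOnInterval_intervalIntegral left_mem_uIcc
  have h2 : AbsolutelyContinuousOnInterval g 0 x := by
    obtain ⟨K, hK⟩ := hgc.contDiffOn.exists_lipschitzOnWith one_ne_zero (convex_uIcc 0 x)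
      isCompact_uIcc
    exact hK.absolutelyContinuousOnInterval
  have h := h1.integral_mul_deriv_eq_deriv_mul h2
  rw [hd] at h
  rw [h, prim_zero, zero_mul, sub_zero]
  congr 1
  refine intervalIntegral.integral_congr_ae ?_
  filter_upwards [hfi.ae_hasDerivAt_integral] with t ht ht'
  rw [show prim f = fun x => ∫ t in (0 : ℝ)..x, f t from rfl,
    (ht (uIoc_subset_uIcc ht') 0 left_mem_uIcc).deriv]

/-- The indicator of `(-∞, x)` in `L²(0,1)`, the kernel of the Volterra operator. -/
def heavi (x : ℝ) : L2I :=
  indicatorConstLp 2 (measurableSet_Iio (a := x)) (measure_ne_top unitVol _) (1 : ℝ)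

/-- Writing the primitive as an inner product yields linearity and boundedness of the Volterra
operator, and exhibits its kernel. -/
theorem inner_heavi (u : L2I) {x : ℝ} (hx : x ∈ Icc (0 : ℝ) 1) :
    inner ℝ (heavi x) u = prim (extZero u) x := by
  rw [heavi, L2.inner_indicatorConstLp_one, prim_congr (extZero_ae u) hx, prim,
    intervalIntegral.integral_of_le hx.1, integral_Ioc_eq_integral_Ioo,
    Measure.restrict_restrict measurableSet_Iio]
  congr 2
  ext t
  simp only [mem_inter_iff, mem_Iio, mem_Ioo]
  constructor
  · rintro ⟨a, b, c⟩; exact ⟨b, a⟩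
  · rintro ⟨a, b⟩; exact ⟨b, a, b.trans_le hx.2⟩

theorem norm_heavi_le (x : ℝ) : ‖heavi x‖ ≤ 1 := by
  have h : ‖heavi x‖ ^ 2 ≤ 1 := by
    rw [← real_inner_self_eq_norm_sq, heavi, L2.real_inner_indicatorConstLp_one_indicatorConstLp_one]
    exact measureReal_le_one
  nlinarith [norm_nonneg (heavi x)]

/-- The Volterra operator `u ↦ ∫₀ˣ u` on `L²(0,1)`. -/
def volterra : L2I →L[ℝ] L2I :=
  LinearMap.mkContinuous
    { toFun := fun u => toL2 (prim (extZero u))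
      map_add' := fun u v => by
        apply Lp.ext
        filter_upwards [toL2_ae (continuous_prim (integrable_extZero (u + v))),
          Lp.coeFn_add (toL2 (prim (extZero u))) (toL2 (prim (extZero v))),
          toL2_ae (continuous_prim (integrable_extZero u)),
          toL2_ae (continuous_prim (integrable_extZero v)),
          ae_restrict_mem measurableSet_Ioo] with x h1 h2 h3 h4 h5
        rw [h1, h2, Pi.add_apply, h3, h4]
        simp only [← inner_heavi _ (Ioo_subset_Icc_self h5), inner_add_right]
      map_smul' := fun c u => by
        apply Lp.ext
        filter_upwards [toL2_ae (continuous_prim (integrable_extZero (c • u))),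
          Lp.coeFn_smul c (toL2 (prim (extZero u))),
          toL2_ae (continuous_prim (integrable_extZero u)),
          ae_restrict_mem measurableSet_Ioo] with x h1 h2 h3 h5
        rw [RingHom.id_apply, h1, h2, Pi.smul_apply, h3]
        simp only [← inner_heavi _ (Ioo_subset_Icc_self h5), inner_smul_right, smul_eq_mul] }
    -- The constant of the embedding of `L^∞` into `L²`; it equals `1` for a probability measure.
    (measureUnivNNReal unitVol ^ (2 : ℝ≥0∞).toReal⁻¹)
    fun u => by
      refine Lp.norm_le_of_ae_bound (norm_nonneg u) ?_
      filter_upwards [toL2_ae (continuous_prim (integrable_extZero u)),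
        ae_restrict_mem measurableSet_Ioo] with x h1 h2
      simp only [LinearMap.coe_mk, AddHom.coe_mk]
      rw [h1, ← inner_heavi _ (Ioo_subset_Icc_self h2)]
      refine (norm_inner_le_norm _ _).trans ?_
      exact mul_le_of_le_one_left (norm_nonneg u) (norm_heavi_le x)

theorem volterra_ae (u : L2I) : volterra u =ᵐ[unitVol] prim (extZero u) :=
  toL2_ae (continuous_prim (integrable_extZero u))

theorem volterra_ae_inner (u : L2I) :
    volterra u =ᵐ[unitVol] fun x => inner ℝ (heavi x) u := by
  filter_upwards [volterra_ae u, ae_restrict_mem measurableSet_Ioo] with x h1 h2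
  rw [h1, inner_heavi _ (Ioo_subset_Icc_self h2)]

theorem prim_extZero_congr {u : L2I} {f : ℝ → ℝ} (h : u =ᵐ[unitVol] f) {x : ℝ}
    (hx : x ∈ Icc (0 : ℝ) 1) : prim (extZero u) x = prim f x :=
  prim_congr ((extZero_ae u).trans h) hx

theorem volterra_ae_of_ae {u : L2I} {f : ℝ → ℝ} (h : u =ᵐ[unitVol] f) :
    volterra u =ᵐ[unitVol] prim f := by
  filter_upwards [volterra_ae u, ae_restrict_mem measurableSet_Ioo] with x h1 h2
  rw [h1, prim_extZero_congr h (Ioo_subset_Icc_self h2)]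

theorem inner_heavi_of_ae {u : L2I} {f : ℝ → ℝ} (h : u =ᵐ[unitVol] f) {x : ℝ}
    (hx : x ∈ Icc (0 : ℝ) 1) : inner ℝ (heavi x) u = prim f x := by
  rw [inner_heavi _ hx, prim_extZero_congr h hx]

/-! ### Weak derivatives -/

theorem IsTest.deriv {φ : ℝ → ℝ} (h : IsTest φ) : IsTest (deriv φ) :=
  ⟨(contDiff_infty_iff_deriv.1 h.1).2, h.2.1.deriv, fun _ hx => h.2.2 (tsupport_deriv_subset hx)⟩

theorem IsTest.hasDerivAt {φ : ℝ → ℝ} (h : IsTest φ) (x : ℝ) : HasDerivAt φ (_root_.deriv φ x) x :=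
  (h.1.differentiable (by simp) x).hasDerivAt

theorem IsTest.eq_zero {φ : ℝ → ℝ} (h : IsTest φ) {x : ℝ} (hx : x ∉ Ioo (0 : ℝ) 1) : φ x = 0 :=
  image_eq_zero_of_notMem_tsupport fun hx' => hx (h.2.2 hx')

theorem IsTest.prim_deriv {φ : ℝ → ℝ} (h : IsTest φ) : prim (_root_.deriv φ) = φ := by
  ext x
  rw [prim, intervalIntegral.integral_eq_sub_of_hasDerivAt (fun y _ => h.hasDerivAt y)
    (h.deriv.1.continuous.intervalIntegrable _ _), h.eq_zero (x := 0) (by simp), sub_zero]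

theorem isWeakDeriv_zero (u : L2I) : IsWeakDeriv 0 u u := fun φ _ => by simp

theorem isWeakDeriv_one_iff {u w : L2I} : IsWeakDeriv 1 u w ↔ ∀ φ, IsTest φ →
    ∫ x in Ioo (0 : ℝ) 1, u x * deriv φ x = -∫ x in Ioo (0 : ℝ) 1, w x * φ x := by
  simp [IsWeakDeriv, iteratedDeriv_one]

theorem IsWeakDeriv.succ {k : ℕ} {u w w' : L2I} (h : IsWeakDeriv k u w) (h' : IsWeakDeriv 1 w w') :
    IsWeakDeriv (k + 1) u w' := by
  intro φ hφ
  rw [iteratedDeriv_succ', h _ hφ.deriv, isWeakDeriv_one_iff.1 h' φ hφ, pow_succ]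
  ring

theorem IsWeakDeriv.step {k : ℕ} {u w w' : L2I} (h : IsWeakDeriv k u w)
    (h' : IsWeakDeriv (k + 1) u w') : IsWeakDeriv 1 w w' := by
  rw [isWeakDeriv_one_iff]
  intro φ hφ
  have h1 := h _ hφ.deriv
  have h2 := h' φ hφ
  rw [iteratedDeriv_succ', h1, pow_succ] at h2
  refine mul_left_cancel₀ (pow_ne_zero k (by norm_num : (-1 : ℝ) ≠ 0)) (h2.trans ?_)
  ring

theorem isWeakDeriv_volterra (u : L2I) : IsWeakDeriv 1 (volterra u) u := by
  rw [isWeakDeriv_one_iff]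
  intro φ hφ
  have h1 : ∫ x in Ioo (0 : ℝ) 1, volterra u x * deriv φ x
      = ∫ x in Ioo (0 : ℝ) 1, prim (extZero u) x * deriv φ x := by
    refine integral_congr_ae ?_
    filter_upwards [volterra_ae u] with x hx
    rw [hx]
  have h2 : ∫ x in Ioo (0 : ℝ) 1, u x * φ x = ∫ x in Ioo (0 : ℝ) 1, extZero u x * φ x := by
    refine integral_congr_ae ?_
    filter_upwards [extZero_ae u] with x hx
    rw [hx]
  rw [h1, h2, integral_Ioo_eq, integral_Ioo_eq,
    integral_prim_mul_deriv (integrable_extZero u) hφ.hasDerivAt hφ.deriv.1.continuous,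
    hφ.eq_zero (x := 1) (by simp)]
  ring

theorem volterra_toL2_deriv {φ : ℝ → ℝ} (h : IsTest φ) : volterra (toL2 (deriv φ)) = toL2 φ := by
  apply Lp.ext
  filter_upwards [volterra_ae_of_ae (toL2_ae h.deriv.1.continuous), toL2_ae h.1.continuous]
    with x h1 h2
  rw [h1, h2, h.prim_deriv]

/-- Duality: `V φ' = φ` for a test function, hence `⟨V* u, φ'⟩ = ⟨u, φ⟩`. -/
theorem isWeakDeriv_adjoint_volterra (u : L2I) : IsWeakDeriv 1 (volterra.adjoint u) (-u) := by
  rw [isWeakDeriv_one_iff]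
  intro φ hφ
  rw [← inner_toL2 _ hφ.deriv.1.continuous, ← inner_toL2 _ hφ.1.continuous,
    ContinuousLinearMap.adjoint_inner_left, volterra_toL2_deriv hφ, inner_neg_left, neg_neg]

theorem exists_isTest_integral_eq_one : ∃ ρ : ℝ → ℝ, IsTest ρ ∧ ∫ x in Ioo (0 : ℝ) 1, ρ x = 1 := by
  let b : ContDiffBump (1 / 2 : ℝ) := ⟨1 / 8, 1 / 4, by norm_num, by norm_num⟩
  have hs : tsupport (b.normed volume) ⊆ Ioo (0 : ℝ) 1 := by
    rw [b.tsupport_normed_eq]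
    intro x hx
    rw [mem_closedBall_iff_norm, Real.norm_eq_abs, abs_le] at hx
    simp only [b] at hx
    constructor <;> linarith [hx.1, hx.2]
  refine ⟨b.normed volume, ⟨b.contDiff_normed, b.hasCompactSupport_normed, hs⟩, ?_⟩
  rw [setIntegral_eq_integral_of_forall_compl_eq_zero, b.integral_normed]
  exact fun x hx => image_eq_zero_of_notMem_tsupport fun hx' => hx (hs hx')

/-- A test function with vanishing integral is the derivative of a test function. -/
theorem IsTest.isTest_prim {θ : ℝ → ℝ} (h : IsTest θ) (h0 : ∫ x in Ioo (0 : ℝ) 1, θ x = 0) :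
    IsTest (prim θ) := by
  have hd : _root_.deriv (prim θ) = θ :=
    funext fun x => (hasDerivAt_prim h.1.continuous x).deriv
  -- The primitive vanishes left of `a` because `θ` does, and right of `b` because the total
  -- integral is zero.
  obtain ⟨a, b, ha, hb, hab⟩ : ∃ a b : ℝ, 0 < a ∧ b < 1 ∧ tsupport θ ⊆ Icc a b := by
    rcases (tsupport θ).eq_empty_or_nonempty with he | hne
    · exact ⟨1 / 2, 1 / 2, by norm_num, by norm_num, by simp [he]⟩
    · have hK : IsCompact (tsupport θ) := h.2.1
      exact ⟨sInf (tsupport θ), sSup (tsupport θ), (h.2.2 (hK.sInf_mem hne)).1,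
        (h.2.2 (hK.sSup_mem hne)).2, subset_Icc_csInf_csSup hK.bddBelow hK.bddAbove⟩
  have hz : ∀ t, t ∉ Icc a b → θ t = 0 := fun t ht =>
    image_eq_zero_of_notMem_tsupport fun ht' => ht (hab ht')
  have hsupp : tsupport (prim θ) ⊆ Icc a b := by
    refine closure_minimal ?_ isClosed_Icc
    intro x hx
    by_contra hxab
    apply hx
    rw [mem_Icc, not_and_or, not_le, not_le] at hxab
    rcases hxab with hxa | hxb
    · rw [prim, intervalIntegral.integral_congr (g := fun _ => (0 : ℝ)),
        intervalIntegral.integral_zero]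
      intro t ht
      refine hz t fun ht' => ?_
      rcases le_total 0 x with h0 | h0
      · rw [uIcc_of_le h0] at ht; linarith [ht.2, ht'.1]
      · rw [uIcc_of_ge h0] at ht; linarith [ht.2, ht'.1]
    · rw [integral_Ioo_eq] at h0
      have hc := h.1.continuous
      rw [prim, ← intervalIntegral.integral_add_adjacent_intervals
        (hc.intervalIntegrable 0 1) (hc.intervalIntegrable 1 x), h0, zero_add,
        intervalIntegral.integral_congr (g := fun _ => (0 : ℝ)), intervalIntegral.integral_zero]
      intro t ht
      refine hz t fun ht' => ?_
      rcases le_total 1 x with h0 | h0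
      · rw [uIcc_of_le h0] at ht; linarith [ht.1, ht'.2]
      · rw [uIcc_of_ge h0] at ht; linarith [ht.1, ht'.2]
  refine ⟨contDiff_infty_iff_deriv.2
    ⟨fun x => (hasDerivAt_prim h.1.continuous x).differentiableAt, hd.symm ▸ h.1⟩,
    isCompact_Icc.of_isClosed_subset (isClosed_tsupport _) hsupp, hsupp.trans ?_⟩
  exact fun x hx => ⟨ha.trans_le hx.1, hx.2.trans_lt hb⟩

theorem IsTest.sub_smul {φ ψ : ℝ → ℝ} (h : IsTest φ) (h' : IsTest ψ) (c : ℝ) :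
    IsTest (φ - c • ψ) := by
  refine ⟨h.1.sub (h'.1.const_smul c), h.2.1.sub (h'.2.1.smul_left (f := fun _ => c)), ?_⟩
  refine (tsupport_sub φ (c • ψ)).trans (union_subset h.2.2 ?_)
  exact (tsupport_smul_subset_right (fun _ => c) ψ).trans h'.2.2

/-- The lemma of du Bois-Reymond. -/
theorem IsWeakDeriv.ae_const {u : L2I} (h : IsWeakDeriv 1 u 0) :
    ∃ c : ℝ, u =ᵐ[unitVol] fun _ => c := by
  obtain ⟨ρ, hρ, hρ1⟩ := exists_isTest_integral_eq_one
  refine ⟨∫ x in Ioo (0 : ℝ) 1, u x * ρ x, ?_⟩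
  set c := ∫ x in Ioo (0 : ℝ) 1, u x * ρ x with hc
  have hi : IntegrableOn (fun x => u x - c) (Ioo (0 : ℝ) 1) :=
    ((Lp.memLp u).integrable (by norm_num)).sub (integrable_const c)
  have hint : ∀ ψ, IsTest ψ → Integrable ψ unitVol := fun ψ hψ =>
    (hψ.1.continuous.integrable_of_hasCompactSupport hψ.2.1).restrict
  have hz := isOpen_Ioo.ae_eq_zero_of_integral_contDiff_smul_eq_zero hi.locallyIntegrableOn
    (by
      intro ψ hψ1 hψ2 hψ3
      have hψ : IsTest ψ := ⟨hψ1, hψ2, hψ3⟩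
      rw [← setIntegral_eq_integral_of_forall_compl_eq_zero (s := Ioo (0 : ℝ) 1)
        (fun x hx => by simp [hψ.eq_zero hx])]
      set m := ∫ x in Ioo (0 : ℝ) 1, ψ x with hm
      -- Subtracting `m ρ` makes the integral zero, so the difference is the derivative of a test
      -- function and `u` annihilates it.
      have hθ : IsTest (ψ - m • ρ) := hψ.sub_smul hρ m
      have hθ0 : ∫ x in Ioo (0 : ℝ) 1, (ψ - m • ρ) x = 0 := by
        simp only [Pi.sub_apply, Pi.smul_apply, smul_eq_mul]
        rw [integral_sub (hint ψ hψ) ((hint ρ hρ).const_mul m), integral_const_mul, hρ1]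
        simp [hm]
      have h1 := isWeakDeriv_one_iff.1 h _ (hθ.isTest_prim hθ0)
      have hd : deriv (prim (ψ - m • ρ)) = ψ - m • ρ :=
        funext fun x => (hasDerivAt_prim hθ.1.continuous x).deriv
      have h2 : ∫ x in Ioo (0 : ℝ) 1, (0 : L2I) x * prim (ψ - m • ρ) x = 0 := by
        refine integral_eq_zero_of_ae ?_
        filter_upwards [Lp.coeFn_zero ℝ 2 unitVol] with x hx
        rw [hx]; simp
      rw [hd, h2, neg_zero] at h1
      have h3 : ∫ x in Ioo (0 : ℝ) 1, u x * (ψ - m • ρ) x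
          = (∫ x in Ioo (0 : ℝ) 1, u x * ψ x) - m * c := by
        rw [hc, ← integral_const_mul, ← integral_sub (hψ.integrable_zero u)
          ((hρ.integrable_zero u).const_mul m)]
        refine integral_congr_ae (Filter.Eventually.of_forall fun x => ?_)
        simp only [Pi.sub_apply, Pi.smul_apply, smul_eq_mul]
        ring
      calc ∫ x in Ioo (0 : ℝ) 1, ψ x • (u x - c)
          = ∫ x in Ioo (0 : ℝ) 1, (u x * ψ x - c * ψ x) := by
            congr 1; ext x; simp only [smul_eq_mul]; ring
        _ = (∫ x in Ioo (0 : ℝ) 1, u x * ψ x) - c * m := by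
            rw [integral_sub (hψ.integrable_zero u) ((hint ψ hψ).const_mul c),
              integral_const_mul]
        _ = 0 := by linarith)
  rw [Filter.EventuallyEq, ae_restrict_iff' measurableSet_Ioo]
  filter_upwards [hz] with x hx hxI
  exact sub_eq_zero.1 (hx hxI)

theorem IsWeakDeriv.sub {k : ℕ} {u u' w w' : L2I} (h : IsWeakDeriv k u w)
    (h' : IsWeakDeriv k u' w') : IsWeakDeriv k (u - u') (w - w') := by
  have := h.add (h'.smul (-1))
  simpa only [neg_smul, one_smul, ← sub_eq_add_neg] using this

/-- `u` and `V w` have the same weak derivative, so du Bois-Reymond applies to their difference. -/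
theorem IsWeakDeriv.ae_prim {u w : L2I} (h : IsWeakDeriv 1 u w) {f : ℝ → ℝ}
    (hf : w =ᵐ[unitVol] f) : ∃ c : ℝ, u =ᵐ[unitVol] fun x => c + prim f x := by
  have h1 := h.sub (isWeakDeriv_volterra w)
  rw [sub_self] at h1
  obtain ⟨c, hc⟩ := h1.ae_const
  refine ⟨c, ?_⟩
  filter_upwards [hc, Lp.coeFn_sub u (volterra w), volterra_ae_of_ae hf] with x h2 h3 h4
  rw [h3, Pi.sub_apply, h4] at h2
  linarith

theorem isWeakDeriv_of_hasDerivAt {f f' : ℝ → ℝ} (hf : ∀ x, HasDerivAt f (f' x) x)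
    (hf' : Continuous f') : IsWeakDeriv 1 (toL2 f) (toL2 f') := by
  have hfc : Continuous f := continuous_iff_continuousAt.2 fun x => (hf x).continuousAt
  rw [isWeakDeriv_one_iff]
  intro φ hφ
  have e : ∀ {g : ℝ → ℝ} (ψ : ℝ → ℝ), Continuous g → ∫ x in Ioo (0 : ℝ) 1, toL2 g x * ψ x
      = ∫ x in (0 : ℝ)..1, g x * ψ x := by
    intro g ψ hg
    rw [← integral_Ioo_eq]
    refine integral_congr_ae ?_
    filter_upwards [toL2_ae hg] with x hx
    rw [hx]
  rw [e _ hfc, e _ hf', intervalIntegral.integral_mul_deriv_eq_deriv_mul (fun x _ => hf x)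
    (fun x _ => hφ.hasDerivAt x) (hf'.intervalIntegrable _ _)
    (hφ.deriv.1.continuous.intervalIntegrable _ _), hφ.eq_zero (x := 1) (by simp),
    hφ.eq_zero (x := 0) (by simp)]
  ring

/-! ### The Green operator -/

/-- The constant function `1` in `L²(0,1)`. -/
def oneL2 : L2I := toL2 fun _ => 1

/-- The function `x - 1/2` in `L²(0,1)`. -/
def linL2 : L2I := toL2 fun x => x - 1 / 2

theorem inner_toL2_toL2 {f g : ℝ → ℝ} (hf : Continuous f) (hg : Continuous g) :
    inner ℝ (toL2 f) (toL2 g) = ∫ x in (0 : ℝ)..1, f x * g x := by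
  rw [inner_toL2 _ hg, ← integral_Ioo_eq]
  refine integral_congr_ae ?_
  filter_upwards [toL2_ae hf] with x hx
  rw [hx]

theorem inner_one_one : inner ℝ oneL2 oneL2 = 1 := by
  rw [oneL2, inner_toL2_toL2 (by fun_prop) (by fun_prop)]
  simp

theorem inner_one_lin : inner ℝ oneL2 linL2 = 0 := by
  rw [oneL2, linL2, inner_toL2_toL2 (by fun_prop) (by fun_prop)]
  simp only [one_mul]
  rw [intervalIntegral.integral_sub (by simp) (by simp), integral_id]
  simp

theorem inner_lin_lin : inner ℝ linL2 linL2 = 1 / 12 := by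
  rw [linL2, inner_toL2_toL2 (by fun_prop) (by fun_prop)]
  have h : ∀ x ∈ uIcc (0 : ℝ) 1, HasDerivAt (fun x : ℝ => (x - 1 / 2) ^ 3 / 3)
      ((x - 1 / 2) * (x - 1 / 2)) x := by
    intro x _
    have := (((hasDerivAt_id x).sub_const (1 / 2)).pow 3).div_const 3
    convert! this using 1
    simp; ring
  rw [intervalIntegral.integral_eq_sub_of_hasDerivAt h
    ((by fun_prop : Continuous fun x : ℝ => (x - 1 / 2) * (x - 1 / 2)).intervalIntegrable _ _)]
  norm_num

theorem toL2_affine (a b : ℝ) : toL2 (fun x => a + b * x) = (a + b / 2) • oneL2 + b • linL2 := by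
  apply Lp.ext
  have hl : Continuous fun x : ℝ => x - 1 / 2 := by fun_prop
  have ha : Continuous fun x : ℝ => a + b * x := by fun_prop
  filter_upwards [toL2_ae ha,
    Lp.coeFn_add ((a + b / 2) • oneL2) (b • linL2), Lp.coeFn_smul (a + b / 2) oneL2,
    Lp.coeFn_smul b linL2, toL2_ae (continuous_const (y := (1 : ℝ))), toL2_ae hl]
    with x h1 h2 h3 h4 h5 h6
  rw [h1, h2, Pi.add_apply, h3, h4, Pi.smul_apply, Pi.smul_apply, oneL2, linL2, h5, h6]
  simp only [smul_eq_mul]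
  ring

/-- The orthogonal projection onto the complement of the affine functions. -/
def affProj : L2I →L[ℝ] L2I :=
  ContinuousLinearMap.id ℝ L2I - InnerProductSpace.rankOne ℝ oneL2 oneL2
    -- `12` is the inverse of `‖linL2‖²`.
    - (12 : ℝ) • InnerProductSpace.rankOne ℝ linL2 linL2

theorem affProj_apply (u : L2I) :
    affProj u = u - inner ℝ oneL2 u • oneL2 - (12 * inner ℝ linL2 u) • linL2 := by
  simp [affProj, smul_smul]

theorem inner_affProj_left (u v : L2I) : inner ℝ (affProj u) v
    = inner ℝ u v - inner ℝ oneL2 u * inner ℝ oneL2 v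
      - 12 * (inner ℝ linL2 u * inner ℝ linL2 v) := by
  rw [affProj_apply, inner_sub_left, inner_sub_left, real_inner_smul_left, real_inner_smul_left]
  ring

theorem inner_affProj_right (u v : L2I) : inner ℝ u (affProj v) = inner ℝ (affProj u) v := by
  rw [real_inner_comm, inner_affProj_left, inner_affProj_left, real_inner_comm v u]
  ring

theorem adjoint_affProj : affProj.adjoint = affProj := by
  symm
  rw [ContinuousLinearMap.eq_adjoint_iff]
  exact fun u v => (inner_affProj_right u v).symm

theorem inner_one_affProj (u : L2I) : inner ℝ oneL2 (affProj u) = 0 := by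
  rw [inner_affProj_right, inner_affProj_left, inner_one_one, real_inner_comm oneL2 linL2,
    inner_one_lin]
  ring

theorem inner_lin_affProj (u : L2I) : inner ℝ linL2 (affProj u) = 0 := by
  rw [inner_affProj_right, inner_affProj_left, inner_lin_lin, inner_one_lin]
  ring

theorem affProj_eq_self {u : L2I} (h1 : inner ℝ oneL2 u = 0) (h2 : inner ℝ linL2 u = 0) :
    affProj u = u := by
  rw [affProj_apply, h1, h2]; simp

theorem affProj_affine (a b : ℝ) : affProj (a • oneL2 + b • linL2) = 0 := by
  rw [affProj_apply]
  simp only [inner_add_right, real_inner_smul_right, inner_one_one, inner_one_lin, inner_lin_lin,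
    real_inner_comm oneL2 linL2]
  module

/-- Double integration from the left endpoint. -/
def volterraSq : L2I →L[ℝ] L2I := volterra ∘L volterra

/-- The Green operator of the clamped problem. -/
def green : L2I →L[ℝ] L2I := volterraSq ∘L affProj ∘L volterraSq.adjoint

theorem adjoint_volterraSq_apply (u : L2I) :
    volterraSq.adjoint u = volterra.adjoint (volterra.adjoint u) := by
  rw [volterraSq, ContinuousLinearMap.adjoint_comp]; rfl

theorem prim_one_eq_inner (u : L2I) : prim (extZero u) 1 = inner ℝ oneL2 u := by
  rw [oneL2, real_inner_comm, inner_toL2 _ (by fun_prop), prim_congr (extZero_ae u) (by simp),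
    integral_Ioo_eq, prim]
  simp

/-- The double primitive at `1` is `∫ (1 - t) u(t)`, and `1 - t = 1/2 - (t - 1/2)`. This turns the
condition at the right end into orthogonality. -/
theorem prim_prim_one_eq_inner (u : L2I) :
    prim (prim (extZero u)) 1 = inner ℝ oneL2 u / 2 - inner ℝ linL2 u := by
  have h := integral_prim_mul_deriv (integrable_extZero u) (g := fun x => x) (g' := fun _ => 1)
    (fun x => hasDerivAt_id x) continuous_const 1
  simp only [mul_one] at h
  rw [prim, h, prim_one_eq_inner]
  have e : ∫ t in (0 : ℝ)..1, extZero u t * t = inner ℝ u (toL2 fun x => 0 + 1 * x) := by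
    rw [inner_toL2 _ (by fun_prop), ← integral_Ioo_eq]
    refine integral_congr_ae ?_
    filter_upwards [extZero_ae u] with x hx
    rw [hx]; ring
  rw [e, toL2_affine, inner_add_right, real_inner_smul_right, real_inner_smul_right,
    real_inner_comm u oneL2, real_inner_comm u linL2]
  ring

/-- The conditions at `0` are automatic for a double primitive; those at `1` are the two
orthogonality relations. -/
theorem mem_sobolevH20_volterraSq {g : L2I} (h1 : inner ℝ oneL2 g = 0)
    (h2 : inner ℝ linL2 g = 0) : volterraSq g ∈ sobolevH20 := by
  have hc := continuous_prim (integrable_extZero g)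
  have hd : deriv (prim (prim (extZero g))) = prim (extZero g) :=
    funext fun x => (hasDerivAt_prim hc x).deriv
  have w1 : IsWeakDeriv 1 (volterraSq g) (volterra g) := isWeakDeriv_volterra _
  refine ⟨?_, prim (prim (extZero g)), contDiff_one_iff_deriv.2
    ⟨fun x => (hasDerivAt_prim hc x).differentiableAt, hd.symm ▸ hc⟩,
    volterra_ae_of_ae (volterra_ae g), prim_zero _, ?_, ?_, ?_⟩
  · intro k hk
    interval_cases k
    · exact ⟨_, isWeakDeriv_zero _⟩
    · exact ⟨_, w1⟩
    · exact ⟨_, w1.succ (isWeakDeriv_volterra g)⟩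
  · rw [hd, prim_zero]
  · rw [prim_prim_one_eq_inner, h1, h2]; simp
  · rw [hd, prim_one_eq_inner, h1]

theorem isWeakDeriv_affine (a b : ℝ) :
    IsWeakDeriv 1 (a • oneL2 + b • linL2) (b • oneL2) := by
  have h1 : IsWeakDeriv 1 oneL2 (toL2 fun _ => 0) :=
    isWeakDeriv_of_hasDerivAt (fun x => hasDerivAt_const x 1) continuous_const
  have h2 : IsWeakDeriv 1 linL2 oneL2 :=
    isWeakDeriv_of_hasDerivAt (fun x => (hasDerivAt_id x).sub_const _) continuous_const
  have h0 : toL2 (fun _ => 0) = 0 := by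
    have := toL2_affine 0 0
    simpa using this
  rw [h0] at h1
  simpa using (h1.smul a).add (h2.smul b)

/-- Two derivatives remove `V²`. The next two remove the affine part subtracted by the projection
and undo the two adjoints, whose signs cancel. -/
theorem exists_isWeakDeriv_green (w : L2I) : ∃ u1 u2 u3 : L2I, IsWeakDeriv 1 (green w) u1 ∧
    IsWeakDeriv 1 u1 u2 ∧ IsWeakDeriv 1 u2 u3 ∧ IsWeakDeriv 1 u3 w := by
  set z := volterraSq.adjoint w with hz
  refine ⟨volterra (affProj z), affProj z, -(volterra.adjoint w)
    - (12 * inner ℝ linL2 z) • oneL2, isWeakDeriv_volterra _, isWeakDeriv_volterra _, ?_, ?_⟩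
  · have h1 : IsWeakDeriv 1 z (-(volterra.adjoint w)) := by
      rw [hz, adjoint_volterraSq_apply]
      exact isWeakDeriv_adjoint_volterra _
    rw [affProj_apply, sub_sub]
    exact h1.sub (isWeakDeriv_affine _ _)
  · have h1 := ((isWeakDeriv_adjoint_volterra w).smul (-1)).sub
      (isWeakDeriv_affine (12 * inner ℝ linL2 z) 0)
    simpa using h1

theorem isWeakDeriv_green (w : L2I) : IsWeakDeriv 4 (green w) w := by
  obtain ⟨u1, u2, u3, h1, h2, h3, h4⟩ := exists_isWeakDeriv_green w
  exact ((h1.succ h2).succ h3).succ h4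

theorem green_mem_domain (w : L2I) : green w ∈ biharmonic.domain := by
  obtain ⟨u1, u2, u3, h1, h2, h3, h4⟩ := exists_isWeakDeriv_green w
  refine ⟨?_, mem_sobolevH20_volterraSq (inner_one_affProj _) (inner_lin_affProj _)⟩
  intro k hk
  interval_cases k
  · exact ⟨_, isWeakDeriv_zero _⟩
  · exact ⟨_, h1⟩
  · exact ⟨_, h1.succ h2⟩
  · exact ⟨_, (h1.succ h2).succ h3⟩
  · exact ⟨_, ((h1.succ h2).succ h3).succ h4⟩

theorem biharmonic_green (w : L2I) : biharmonic ⟨green w, green_mem_domain w⟩ = w :=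
  (biharmonic_spec ⟨green w, green_mem_domain w⟩).unique (isWeakDeriv_green w)

/-- Pointwise representation of the functions in the domain. -/
theorem exists_rep_of_mem_domain (u : biharmonic.domain) : ∃ a b : ℝ,
    ((u : L2I) =ᵐ[unitVol]
      prim (prim fun x => a + prim (fun y => b + prim (extZero (biharmonic u)) y) x))
    ∧ prim (fun x => a + prim (fun y => b + prim (extZero (biharmonic u)) y) x) 1 = 0
    ∧ prim (prim fun x => a + prim (fun y => b + prim (extZero (biharmonic u)) y) x) 1 = 0 := by
  obtain ⟨hH4, -, U, hU, huU, hU0, hU0', hU1, hU1'⟩ := u.2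
  obtain ⟨u1, h1⟩ := hH4 1 (by norm_num)
  obtain ⟨u2, h2⟩ := hH4 2 (by norm_num)
  obtain ⟨u3, h3⟩ := hH4 3 (by norm_num)
  have h4 := biharmonic_spec u
  obtain ⟨b, hb⟩ := (h3.step h4).ae_prim (extZero_ae _).symm
  obtain ⟨a, ha⟩ := (h2.step h3).ae_prim hb
  obtain ⟨c, hc⟩ := (h1.step h2).ae_prim ha
  obtain ⟨d, hd⟩ := h1.ae_prim hc
  have hc3 : Continuous fun y => b + prim (extZero (biharmonic u)) y :=
    continuous_const.add (continuous_prim (integrable_extZero _))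
  have hc2 : Continuous fun x => a + prim (fun y => b + prim (extZero (biharmonic u)) y) x :=
    continuous_const.add (continuous_prim_of_continuous hc3)
  set U2 := fun x => a + prim (fun y => b + prim (extZero (biharmonic u)) y) x with hU2
  have hc1 : Continuous fun x => c + prim U2 x :=
    continuous_const.add (continuous_prim_of_continuous hc2)
  have hc0 : Continuous fun x => d + prim (fun x => c + prim U2 x) x :=
    continuous_const.add (continuous_prim_of_continuous hc1)
  have hder : ∀ x, HasDerivAt (fun x => d + prim (fun x => c + prim U2 x) x) (c + prim U2 x) x :=
    fun x => (hasDerivAt_prim hc1 x).const_add d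
  -- Continuous functions equal almost everywhere on `(0,1)` agree on `[0,1]`; this carries the
  -- boundary values over to the iterated primitive.
  have e : EqOn U (fun x => d + prim (fun x => c + prim U2 x) x) (Icc 0 1) := by
    refine Measure.eqOn_Icc_of_ae_eq (μ := volume) zero_ne_one ?_ hU.continuous.continuousOn
      hc0.continuousOn
    rw [← restrict_Ioo_eq_restrict_Icc]
    exact huU.symm.trans hd
  -- Derivatives are compared inside first; the endpoints follow by continuity, since `deriv U`
  -- there also depends on values outside `[0,1]`.
  have e' : EqOn (deriv U) (fun x => c + prim U2 x) (Icc 0 1) := by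
    have h : EqOn (deriv U) (fun x => c + prim U2 x) (Ioo 0 1) := by
      intro x hx
      have : U =ᶠ[nhds x] fun x => d + prim (fun x => c + prim U2 x) x := by
        filter_upwards [Ioo_mem_nhds hx.1 hx.2] with y hy
        exact e (Ioo_subset_Icc_self hy)
      rw [this.deriv_eq, (hder x).deriv]
    have h' := h.closure (hU.continuous_deriv le_rfl) hc1
    rwa [closure_Ioo zero_ne_one] at h'
  have hd0 : d = 0 := by
    have := e (left_mem_Icc.2 zero_le_one)
    simpa [hU0] using this.symm
  have hc00 : c = 0 := by
    have := e' (left_mem_Icc.2 zero_le_one)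
    simpa [hU0'] using this.symm
  subst hd0 hc00
  simp only [zero_add] at e e' hd
  refine ⟨a, b, hd, ?_, ?_⟩
  · exact (e' (right_mem_Icc.2 zero_le_one)).symm.trans hU1'
  · exact (e (right_mem_Icc.2 zero_le_one)).symm.trans hU1

/-- Here `u = V² u₂` with `u₂ = u''` orthogonal to affine functions. Both `u₂` and `(V²)* w` have
second derivative `w`, so they differ by an affine function, which the projection kills. -/
theorem green_biharmonic (u : biharmonic.domain) : green (biharmonic u) = u := by
  obtain ⟨a, b, h, h1, h0⟩ := exists_rep_of_mem_domain u
  set w := biharmonic u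
  have hc3 : Continuous fun y => b + prim (extZero w) y :=
    continuous_const.add (continuous_prim (integrable_extZero _))
  have hc2 : Continuous fun x => a + prim (fun y => b + prim (extZero w) y) x :=
    continuous_const.add (continuous_prim_of_continuous hc3)
  set U2 := fun x => a + prim (fun y => b + prim (extZero w) y) x with hU2
  set u2 := toL2 U2
  have hu : (u : L2I) = volterraSq u2 := by
    apply Lp.ext
    filter_upwards [h, volterra_ae_of_ae (volterra_ae_of_ae (toL2_ae hc2))] with x hx hx'
    rw [hx]; exact hx'.symm
  have hin1 : inner ℝ oneL2 u2 = 0 := by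
    rw [← prim_one_eq_inner, prim_extZero_congr (toL2_ae hc2) (by simp), h1]
  have hin2 : inner ℝ linL2 u2 = 0 := by
    have := prim_prim_one_eq_inner u2
    have e : prim (prim (extZero u2)) 1 = prim (prim U2) 1 := by
      refine prim_congr ?_ (by simp)
      filter_upwards [ae_restrict_mem measurableSet_Ioo] with x hx
      exact prim_extZero_congr (toL2_ae hc2) (Ioo_subset_Icc_self hx)
    rw [e, h0, hin1] at this
    linarith
  have hw2 : IsWeakDeriv 1 u2 (toL2 fun y => b + prim (extZero w) y) :=
    isWeakDeriv_of_hasDerivAt (fun x => (hasDerivAt_prim hc3 x).const_add a) hc3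
  have hw3 : IsWeakDeriv 1 (toL2 fun y => b + prim (extZero w) y) w := by
    have e : (toL2 fun y => b + prim (extZero w) y) = volterra w + b • oneL2 := by
      apply Lp.ext
      filter_upwards [toL2_ae hc3, volterra_ae w, Lp.coeFn_add (volterra w) (b • oneL2),
        Lp.coeFn_smul b oneL2, toL2_ae (continuous_const (y := (1 : ℝ)))] with x h1 h2 h3 h4 h5
      rw [h1, h3, Pi.add_apply, h2, h4, Pi.smul_apply, oneL2, h5]
      simp [add_comm]
    rw [e]
    simpa using (isWeakDeriv_volterra w).add (isWeakDeriv_affine b 0)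
  have hz1 : IsWeakDeriv 1 (u2 - volterraSq.adjoint w)
      ((toL2 fun y => b + prim (extZero w) y) - -(volterra.adjoint w)) := by
    rw [adjoint_volterraSq_apply]
    exact hw2.sub (isWeakDeriv_adjoint_volterra _)
  have hz2 : IsWeakDeriv 1
      ((toL2 fun y => b + prim (extZero w) y) - -(volterra.adjoint w)) 0 := by
    have := hw3.add (isWeakDeriv_adjoint_volterra w)
    simpa using this
  obtain ⟨c, hc⟩ := hz2.ae_const
  obtain ⟨d, hd⟩ := hz1.ae_prim hc
  have e : u2 - volterraSq.adjoint w = toL2 fun x => d + c * x := by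
    apply Lp.ext
    have ha : Continuous fun x : ℝ => d + c * x := by fun_prop
    filter_upwards [hd, toL2_ae ha] with x h1 h2
    rw [h1, h2]
    simp [prim, mul_comm]
  have hP : affProj (u2 - volterraSq.adjoint w) = 0 := by
    rw [e, toL2_affine, affProj_affine]
  rw [map_sub, sub_eq_zero, affProj_eq_self hin1 hin2] at hP
  rw [hu, hP]; rfl

/-! ### The kernel of the Green operator and its trace -/

/-- Distinct basis vectors are at distance `√2`, so the balls of radius `1/2` around them are
disjoint. -/
theorem hilbertBasis_countable {ι H : Type*} [NormedAddCommGroup H] [InnerProductSpace ℝ H]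
    [TopologicalSpace.SeparableSpace H] (b : HilbertBasis ι ℝ H) : Countable ι := by
  refine Pairwise.countable_of_isOpen_disjoint (s := fun i => Metric.ball (b i) (1 / 2)) ?_
    (fun i => Metric.isOpen_ball) (fun i => ⟨b i, Metric.mem_ball_self (by norm_num)⟩)
  intro i j hij
  refine Metric.ball_disjoint_ball ?_
  have h := norm_sub_sq_real (b i) (b j)
  rw [b.orthonormal.2 hij, b.orthonormal.1, b.orthonormal.1] at h
  rw [dist_eq_norm]
  nlinarith [norm_nonneg (b i - b j)]

instance : TopologicalSpace.SeparableSpace L2I :=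
  have : Fact ((2 : ℝ≥0∞) ≠ ⊤) := ⟨by norm_num⟩
  inferInstance

/-- The function `t ↦ (x - t)₊` in `L²(0,1)`. -/
def ramp (x : ℝ) : L2I := toL2 fun t => max (x - t) 0

theorem inner_toL2_ramp {f : ℝ → ℝ} (hf : Continuous f) {x : ℝ} (hx : x ∈ Icc (0 : ℝ) 1) :
    inner ℝ (toL2 f) (ramp x) = ∫ t in (0 : ℝ)..x, f t * (x - t) := by
  have hc : Continuous fun t : ℝ => f t * max (x - t) 0 := by fun_prop
  rw [ramp, inner_toL2_toL2 hf (by fun_prop), ← intervalIntegral.integral_add_adjacent_intervals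
    (hc.intervalIntegrable 0 x) (hc.intervalIntegrable x 1),
    intervalIntegral.integral_congr (g := fun t => f t * (x - t)) (b := x),
    intervalIntegral.integral_congr (g := fun t => (0 : ℝ)) (a := x),
    intervalIntegral.integral_zero, add_zero]
  · intro t ht
    rw [uIcc_of_le hx.2] at ht
    simp only [max_eq_right (show x - t ≤ 0 by linarith [ht.1]), mul_zero]
  · intro t ht
    rw [uIcc_of_le hx.1] at ht
    simp only [max_eq_left (show 0 ≤ x - t by linarith [ht.2])]

theorem prim_prim_extZero (u : L2I) {x : ℝ} (hx : x ∈ Icc (0 : ℝ) 1) :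
    prim (prim (extZero u)) x = inner ℝ u (ramp x) := by
  have h := integral_prim_mul_deriv (integrable_extZero u) (g := fun t => t - x)
    (g' := fun _ => 1) (fun t => (hasDerivAt_id t).sub_const x) continuous_const x
  simp only [mul_one, sub_self, mul_zero, zero_sub] at h
  have hi := integrable_extZero u
  have hI : ∀ a b, IntervalIntegrable (fun t => extZero u t * max (x - t) 0) volume a b :=
    fun a b => (hi.intervalIntegrable).mul_continuousOn (by fun_prop)
  have e : inner ℝ u (ramp x) = ∫ t in (0 : ℝ)..1, extZero u t * max (x - t) 0 := by
    rw [ramp, inner_toL2 _ (by fun_prop), ← integral_Ioo_eq]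
    refine integral_congr_ae ?_
    filter_upwards [extZero_ae u] with t ht
    rw [ht]
  rw [prim, h, e, ← intervalIntegral.integral_add_adjacent_intervals (hI 0 x) (hI x 1),
    ← intervalIntegral.integral_neg,
    intervalIntegral.integral_congr (f := fun t => extZero u t * max (x - t) 0)
      (g := fun t => -(extZero u t * (t - x))) (b := x),
    intervalIntegral.integral_congr (g := fun t => (0 : ℝ)) (a := x),
    intervalIntegral.integral_zero, add_zero]
  · intro t ht
    rw [uIcc_of_le hx.2] at ht
    simp only [max_eq_right (show x - t ≤ 0 by linarith [ht.1]), mul_zero]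
  · intro t ht
    rw [uIcc_of_le hx.1] at ht
    simp only [max_eq_left (show 0 ≤ x - t by linarith [ht.2])]
    ring

/-- Moving one factor of `V²` onto the kernel of the other identifies the kernel of `V²`. -/
theorem adjoint_volterra_heavi {x : ℝ} (hx : x ∈ Icc (0 : ℝ) 1) :
    volterra.adjoint (heavi x) = ramp x := by
  refine ext_inner_right ℝ fun v => ?_
  rw [ContinuousLinearMap.adjoint_inner_left, inner_heavi_of_ae (volterra_ae v) hx,
    prim_prim_extZero v hx, real_inner_comm]

/-- The kernel of the square root factor of the Green operator. -/
def greenRoot (x : ℝ) : L2I := affProj (ramp x)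

theorem volterraSq_affProj_ae (u : L2I) :
    (volterraSq ∘L affProj) u =ᵐ[unitVol] fun x => inner ℝ (greenRoot x) u := by
  filter_upwards [volterra_ae_inner (volterra (affProj u)), ae_restrict_mem measurableSet_Ioo]
    with x h1 h2
  rw [greenRoot, ← adjoint_volterra_heavi (Ioo_subset_Icc_self h2), ← inner_affProj_right,
    ContinuousLinearMap.adjoint_inner_left, ← h1]
  rfl

theorem integral_eq_of_poly {f F : ℝ → ℝ} (h : ∀ x, HasDerivAt F (f x) x) (hf : Continuous f)
    (a b : ℝ) : ∫ t in a..b, f t = F b - F a :=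
  intervalIntegral.integral_eq_sub_of_hasDerivAt (fun x _ => h x) (hf.intervalIntegrable _ _)

theorem inner_one_ramp {x : ℝ} (hx : x ∈ Icc (0 : ℝ) 1) : inner ℝ oneL2 (ramp x) = x ^ 2 / 2 := by
  rw [oneL2, inner_toL2_ramp continuous_const hx,
    integral_eq_of_poly (F := fun t => x * t - t ^ 2 / 2) (fun t => ?_) (by fun_prop)]
  · simp; ring
  · have := ((hasDerivAt_id t).const_mul x).sub (((hasDerivAt_id t).pow 2).div_const 2)
    convert! this using 1
    simp

theorem inner_lin_ramp {x : ℝ} (hx : x ∈ Icc (0 : ℝ) 1) :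
    inner ℝ linL2 (ramp x) = x ^ 3 / 6 - x ^ 2 / 4 := by
  rw [linL2, inner_toL2_ramp (by fun_prop) hx,
    integral_eq_of_poly (F := fun t => (x + 1 / 2) * t ^ 2 / 2 - t ^ 3 / 3 - x / 2 * t)
      (fun t => ?_) (by fun_prop)]
  · simp; ring
  · have := (((((hasDerivAt_id t).pow 2).const_mul (x + 1 / 2)).div_const 2).sub
      (((hasDerivAt_id t).pow 3).div_const 3)).sub ((hasDerivAt_id t).const_mul (x / 2))
    convert! this using 1
    simp; ring

theorem inner_ramp_ramp {x y : ℝ} (hx : 0 ≤ x) (hxy : x ≤ y) (hy : y ≤ 1) :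
    inner ℝ (ramp y) (ramp x) = x ^ 2 * (3 * y - x) / 6 := by
  rw [show ramp y = toL2 fun t => max (y - t) 0 from rfl, inner_toL2_ramp (by fun_prop)
    ⟨hx, hxy.trans hy⟩, intervalIntegral.integral_congr (g := fun t => (y - t) * (x - t)),
    integral_eq_of_poly (F := fun t => x * y * t - (x + y) * t ^ 2 / 2 + t ^ 3 / 3)
      (fun t => ?_) (by fun_prop)]
  · simp; ring
  · have := (((hasDerivAt_id t).const_mul (x * y)).sub
      ((((hasDerivAt_id t).pow 2).const_mul (x + y)).div_const 2)).add
      (((hasDerivAt_id t).pow 3).div_const 3)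
    convert! this using 1
    simp; ring
  · intro t ht
    rw [uIcc_of_le hx] at ht
    simp only [max_eq_left (show 0 ≤ y - t by linarith [ht.2])]

/-- The explicit Green function below the diagonal. -/
theorem inner_greenRoot {x y : ℝ} (hx : 0 ≤ x) (hxy : x ≤ y) (hy : y ≤ 1) :
    inner ℝ (greenRoot y) (greenRoot x)
      = x ^ 2 * (1 - y) ^ 2 * (3 * y - x - 2 * x * y) / 6 := by
  rw [greenRoot, greenRoot, inner_affProj_left, inner_one_affProj, inner_lin_affProj,
    inner_affProj_right, inner_affProj_left, inner_ramp_ramp hx hxy hy,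
    inner_one_ramp ⟨hx, hxy.trans hy⟩, inner_lin_ramp ⟨hx, hxy.trans hy⟩,
    inner_one_ramp ⟨hx.trans hxy, hy⟩, inner_lin_ramp ⟨hx.trans hxy, hy⟩]
  ring

theorem enorm_greenRoot_sq {x : ℝ} (hx : x ∈ Icc (0 : ℝ) 1) :
    ‖greenRoot x‖ₑ ^ 2 = ENNReal.ofReal (x ^ 3 * (1 - x) ^ 3 / 3) := by
  rw [← ofReal_norm, ← ENNReal.ofReal_pow (norm_nonneg _), ← real_inner_self_eq_norm_sq,
    inner_greenRoot hx.1 le_rfl hx.2]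
  congr 1
  ring

/-- The Beta integral `B(4,4)/3 = (3!·3!/7!)/3`. -/
theorem lintegral_enorm_greenRoot :
    ∫⁻ x, ‖greenRoot x‖ₑ ^ 2 ∂unitVol = ENNReal.ofReal (1 / 420) := by
  have hc : Continuous fun x : ℝ => x ^ 3 * (1 - x) ^ 3 / 3 := by fun_prop
  have h1 : ∫⁻ x, ‖greenRoot x‖ₑ ^ 2 ∂unitVol
      = ∫⁻ x, ENNReal.ofReal (x ^ 3 * (1 - x) ^ 3 / 3) ∂unitVol := by
    refine lintegral_congr_ae ?_
    filter_upwards [ae_restrict_mem measurableSet_Ioo] with x hx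
    exact enorm_greenRoot_sq (Ioo_subset_Icc_self hx)
  rw [h1, ← ofReal_integral_eq_lintegral_ofReal ((memLp_of_continuous hc).integrable (by norm_num)),
    integral_Ioo_eq, integral_eq_of_poly
      (F := fun t => t ^ 4 / 12 - t ^ 5 / 5 + t ^ 6 / 6 - t ^ 7 / 21) (fun t => ?_) hc]
  · norm_num
  · have := ((((hasDerivAt_id t).pow 4).div_const 12).sub
      (((hasDerivAt_id t).pow 5).div_const 5)).add (((hasDerivAt_id t).pow 6).div_const 6)|>.sub
      (((hasDerivAt_id t).pow 7).div_const 21)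
    convert! this using 1
    simp; ring
  · filter_upwards [ae_restrict_mem measurableSet_Ioo] with x hx
    have h2 : 0 ≤ 1 - x := by linarith [hx.2]
    have h3 := hx.1.le
    simp only [Pi.zero_apply]
    positivity

/-! ### Symmetry, trace and compactness of the Green operator. -/

theorem adjoint_volterraSq_affProj :
    (volterraSq ∘L affProj).adjoint = affProj ∘L volterraSq.adjoint := by
  rw [ContinuousLinearMap.adjoint_comp, adjoint_affProj]

theorem affProj_affProj (u : L2I) : affProj (affProj u) = affProj u :=
  affProj_eq_self (inner_one_affProj u) (inner_lin_affProj u)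

/-- Since `P² = P = P*`, the Green operator is `A A*` with `A = V² P`. Symmetry, nonnegativity and
the trace formula all rest on this. -/
theorem inner_green (u v : L2I) : inner ℝ (green u) v
    = inner ℝ (affProj (volterraSq.adjoint u)) (affProj (volterraSq.adjoint v)) := by
  rw [inner_affProj_right, affProj_affProj, ContinuousLinearMap.adjoint_inner_right]
  rfl

theorem green_isSymmetric : green.IsSymmetric := fun u v => by
  change inner ℝ (green u) v = inner ℝ u (green v)
  rw [inner_green, real_inner_comm, ← inner_green, real_inner_comm]

/-- The Hilbert–Schmidt sum of `A*` equals that of `A`, which is the integral of `‖greenRoot x‖²`.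
-/
theorem tsum_enorm_affProj_adjoint {ι : Type*} (b : HilbertBasis ι ℝ L2I) :
    ∑' i, ‖affProj (volterraSq.adjoint (b i))‖ₑ ^ 2 = ENNReal.ofReal (1 / 420) := by
  have := hilbertBasis_countable b
  rw [← lintegral_enorm_greenRoot, ← tsum_enorm_sq_eq_lintegral b volterraSq_affProj_ae,
    ← tsum_enorm_adjoint_sq, adjoint_volterraSq_affProj]
  rfl

/-- The trace of the Green operator. -/
theorem hasSum_inner_green {ι : Type*} (b : HilbertBasis ι ℝ L2I) :
    HasSum (fun i => inner ℝ (green (b i)) (b i)) (1 / 420) := by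
  have h := tsum_enorm_affProj_adjoint b
  have e : ∀ i, ‖affProj (volterraSq.adjoint (b i))‖ₑ ^ 2
      = ENNReal.ofReal (inner ℝ (green (b i)) (b i)) := by
    intro i
    rw [inner_green, real_inner_self_eq_norm_sq, ENNReal.ofReal_pow (norm_nonneg _), ofReal_norm]
  have hnn : ∀ i, 0 ≤ inner ℝ (green (b i)) (b i) := by
    intro i
    rw [inner_green]
    exact real_inner_self_nonneg
  simp_rw [e] at h
  have hs : Summable fun i => inner ℝ (green (b i)) (b i) := by
    have := ENNReal.summable_toReal (h.trans_ne ENNReal.ofReal_ne_top)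
    simpa only [ENNReal.toReal_ofReal (hnn _)] using this
  rw [← ENNReal.ofReal_tsum_of_nonneg hnn hs,
    ENNReal.ofReal_eq_ofReal_iff (tsum_nonneg hnn) (by norm_num)] at h
  exact h ▸ hs.hasSum

theorem volterra_isCompactOperator : IsCompactOperator volterra := by
  obtain ⟨w, b, -⟩ := exists_hilbertBasis ℝ L2I
  have := hilbertBasis_countable b
  refine isCompactOperator_of_summable_norm_sq b _ ?_
  have h : ∑' i, ‖volterra (b i)‖ₑ ^ 2 ≤ 1 := by
    rw [tsum_enorm_sq_eq_lintegral b volterra_ae_inner]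
    calc ∫⁻ x, ‖heavi x‖ₑ ^ 2 ∂unitVol ≤ ∫⁻ x, 1 ∂unitVol := by
          refine lintegral_mono fun x => pow_le_one' ?_ 2
          rw [← ofReal_norm]
          exact ENNReal.ofReal_le_one.2 (norm_heavi_le x)
      _ = 1 := by simp
  have := ENNReal.summable_toReal (ne_top_of_le_ne_top ENNReal.one_ne_top h)
  simpa using this

theorem green_isCompactOperator : IsCompactOperator green :=
  volterra_isCompactOperator.comp_clm (volterra ∘L affProj ∘L volterraSq.adjoint)

/-! ### Simplicity of the eigenvalues -/

/-- Classical solutions of `U⁗ = μ U` on `(0,1)` with clamped boundary conditions, together with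
their first three derivatives. -/
structure IsClampedSol (μ : ℝ) (U₀ U₁ U₂ U₃ : ℝ → ℝ) : Prop where
  deriv_zero : ∀ x, HasDerivAt U₀ (U₁ x) x
  deriv_one : ∀ x, HasDerivAt U₁ (U₂ x) x
  deriv_two : ∀ x, HasDerivAt U₂ (U₃ x) x
  -- Only on the open interval: in the application `U₃` is a primitive of a function extended by
  -- zero outside it.
  deriv_three : ∀ x ∈ Ioo (0 : ℝ) 1, HasDerivAt U₃ (μ * U₀ x) x
  cont : Continuous U₃
  left_zero : U₀ 0 = 0
  left_one : U₁ 0 = 0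
  right_zero : U₀ 1 = 0
  right_one : U₁ 1 = 0

theorem IsClampedSol.comb {μ : ℝ} {U₀ U₁ U₂ U₃ V₀ V₁ V₂ V₃ : ℝ → ℝ} (hU : IsClampedSol μ U₀ U₁ U₂ U₃)
    (hV : IsClampedSol μ V₀ V₁ V₂ V₃) (r s : ℝ) :
    IsClampedSol μ (fun x => r * U₀ x - s * V₀ x) (fun x => r * U₁ x - s * V₁ x)
      (fun x => r * U₂ x - s * V₂ x) (fun x => r * U₃ x - s * V₃ x) where
  deriv_zero x := ((hU.deriv_zero x).const_mul r).sub ((hV.deriv_zero x).const_mul s)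
  deriv_one x := ((hU.deriv_one x).const_mul r).sub ((hV.deriv_one x).const_mul s)
  deriv_two x := ((hU.deriv_two x).const_mul r).sub ((hV.deriv_two x).const_mul s)
  deriv_three x hx := by
    have := ((hU.deriv_three x hx).const_mul r).sub ((hV.deriv_three x hx).const_mul s)
    convert! this using 1
    ring
  cont := (continuous_const.mul hU.cont).sub (continuous_const.mul hV.cont)
  left_zero := by simp [hU.left_zero, hV.left_zero]
  left_one := by simp [hU.left_one, hV.left_one]
  right_zero := by simp [hU.right_zero, hV.right_zero]
  right_one := by simp [hU.right_one, hV.right_one]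

theorem eq_of_hasDerivAt_zero {f : ℝ → ℝ} (hf : Continuous f)
    (h : ∀ x ∈ Ioo (0 : ℝ) 1, HasDerivAt f 0 x) {x : ℝ} (hx : x ∈ Icc (0 : ℝ) 1) : f x = f 0 := by
  rcases hx.1.eq_or_lt with rfl | h0
  · rfl
  obtain ⟨c, -, hc⟩ := exists_hasDerivAt_eq_slope f (fun _ => 0) h0 hf.continuousOn
    fun y hy => h y ⟨hy.1, hy.2.trans_le hx.2⟩
  rw [eq_div_iff (by linarith), zero_mul] at hc
  linarith

/-- Factoring `D⁴ - k⁴` shows that `(D³ ± kD² + k²D ± k³)U` is a multiple of `e^{±kx}`, and `W = U''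
- k²U` solves `W'' = -k²W`, with conserved energy `W'² + k²W²`. When `U''(0) = 0` all three
constants are determined by `b = U'''(0)`. At `x = 1` they combine to `2b² = b²(e^{2k} + e^{-2k})`,
so `b = 0`, and then `U` vanishes. Thus a solution is determined by `U''(0)`. -/
theorem IsClampedSol.eq_zero {k : ℝ} (hk : 0 < k) {U₀ U₁ U₂ U₃ : ℝ → ℝ}
    (h : IsClampedSol (k ^ 4) U₀ U₁ U₂ U₃) (h2 : U₂ 0 = 0) {x : ℝ} (hx : x ∈ Icc (0 : ℝ) 1) :
    U₀ x = 0 := by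
  have c0 : Continuous U₀ := continuous_iff_continuousAt.2 fun x => (h.deriv_zero x).continuousAt
  have c1 : Continuous U₁ := continuous_iff_continuousAt.2 fun x => (h.deriv_one x).continuousAt
  have c2 : Continuous U₂ := continuous_iff_continuousAt.2 fun x => (h.deriv_two x).continuousAt
  have c3 := h.cont
  have hA : ∀ x ∈ Icc (0 : ℝ) 1,
      (U₃ x + k * U₂ x + k ^ 2 * U₁ x + k ^ 3 * U₀ x) * Real.exp (-k * x) = U₃ 0 := by
    intro x hx
    rw [eq_of_hasDerivAt_zero (f := fun x => (U₃ x + k * U₂ x + k ^ 2 * U₁ x + k ^ 3 * U₀ x)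
      * Real.exp (-k * x)) (by fun_prop) (fun y hy => ?_) hx]
    · simp [h2, h.left_zero, h.left_one]
    · have := ((((h.deriv_three y hy).add ((h.deriv_two y).const_mul k)).add
        ((h.deriv_one y).const_mul (k ^ 2))).add ((h.deriv_zero y).const_mul (k ^ 3))).mul
        ((hasDerivAt_id y).const_mul (-k)).exp
      convert! this using 1
      simp; ring
  have hB : ∀ x ∈ Icc (0 : ℝ) 1,
      (U₃ x - k * U₂ x + k ^ 2 * U₁ x - k ^ 3 * U₀ x) * Real.exp (k * x) = U₃ 0 := by
    intro x hx
    rw [eq_of_hasDerivAt_zero (f := fun x => (U₃ x - k * U₂ x + k ^ 2 * U₁ x - k ^ 3 * U₀ x)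
      * Real.exp (k * x)) (by fun_prop) (fun y hy => ?_) hx]
    · simp [h2, h.left_zero, h.left_one]
    · have := ((((h.deriv_three y hy).sub ((h.deriv_two y).const_mul k)).add
        ((h.deriv_one y).const_mul (k ^ 2))).sub ((h.deriv_zero y).const_mul (k ^ 3))).mul
        ((hasDerivAt_id y).const_mul k).exp
      convert! this using 1
      simp; ring
  have hE : ∀ x ∈ Icc (0 : ℝ) 1,
      (U₃ x - k ^ 2 * U₁ x) ^ 2 + k ^ 2 * (U₂ x - k ^ 2 * U₀ x) ^ 2 = U₃ 0 ^ 2 := by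
    intro x hx
    rw [eq_of_hasDerivAt_zero (f := fun x => (U₃ x - k ^ 2 * U₁ x) ^ 2
      + k ^ 2 * (U₂ x - k ^ 2 * U₀ x) ^ 2) (by fun_prop) (fun y hy => ?_) hx]
    · simp [h2, h.left_zero, h.left_one]
    · have := (((h.deriv_three y hy).sub ((h.deriv_one y).const_mul (k ^ 2))).pow 2).add
        ((((h.deriv_two y).sub ((h.deriv_zero y).const_mul (k ^ 2))).pow 2).const_mul (k ^ 2))
      convert! this using 1
      simp; ring
  have hb : U₃ 0 = 0 := by
    have i1 : (1 : ℝ) ∈ Icc (0 : ℝ) 1 := right_mem_Icc.2 zero_le_one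
    have a := hA 1 i1
    have b := hB 1 i1
    have e := hE 1 i1
    rw [h.right_zero, h.right_one] at a b e
    simp only [mul_zero, add_zero, sub_zero, mul_one] at a b e
    set s := Real.exp k with hs
    set t := Real.exp (-k) with ht
    have hst : s * t = 1 := by rw [hs, ht, ← Real.exp_add]; simp
    have hlt : t < s := Real.exp_lt_exp.2 (by linarith)
    have a' : U₃ 1 + k * U₂ 1 = U₃ 0 * s := by
      linear_combination s * a - (U₃ 1 + k * U₂ 1) * hst
    have b' : U₃ 1 - k * U₂ 1 = U₃ 0 * t := by
      linear_combination t * b - (U₃ 1 - k * U₂ 1) * hst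
    have key : U₃ 0 ^ 2 * (s - t) ^ 2 = 0 := by
      linear_combination 2 * e - 2 * U₃ 0 ^ 2 * hst - (U₃ 1 + k * U₂ 1 + U₃ 0 * s) * a'
        - (U₃ 1 - k * U₂ 1 + U₃ 0 * t) * b'
    have h3 : (s - t) ^ 2 ≠ 0 := pow_ne_zero 2 (by linarith)
    exact pow_eq_zero_iff two_ne_zero |>.1 ((mul_eq_zero.1 key).resolve_right h3)
  have a := (mul_eq_zero.1 ((hA x hx).trans hb)).resolve_right (Real.exp_ne_zero _)
  have b := (mul_eq_zero.1 ((hB x hx).trans hb)).resolve_right (Real.exp_ne_zero _)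
  have e := hE x hx
  rw [hb] at e
  have e1 : U₃ x - k ^ 2 * U₁ x = 0 := by
    nlinarith [sq_nonneg (U₃ x - k ^ 2 * U₁ x),
      mul_nonneg (sq_nonneg k) (sq_nonneg (U₂ x - k ^ 2 * U₀ x))]
  have e2 : U₂ x - k ^ 2 * U₀ x = 0 := by
    rw [e1] at e
    have : k ^ 2 * (U₂ x - k ^ 2 * U₀ x) ^ 2 = 0 := by linarith
    exact pow_eq_zero_iff two_ne_zero |>.1 ((mul_eq_zero.1 this).resolve_left (by positivity))
  have : k ^ 3 * U₀ x = 0 := by linear_combination (a - b) / 4 - k / 2 * e2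
  exact (mul_eq_zero.1 this).resolve_left (by positivity)

theorem mem_eigenspace_iff {μ : ℝ} {u : biharmonic.domain} :
    u ∈ eigenspace μ ↔ biharmonic u = μ • (u : L2I) := by
  rw [eigenspace, LinearMap.mem_ker, LinearMap.sub_apply, sub_eq_zero]
  rfl

theorem exists_isClampedSol {μ : ℝ} {u : biharmonic.domain} (hu : u ∈ eigenspace μ) :
    ∃ U₀ U₁ U₂ U₃, IsClampedSol μ U₀ U₁ U₂ U₃ ∧ (u : L2I) =ᵐ[unitVol] U₀ := by
  obtain ⟨a, b, h, h1, h0⟩ := exists_rep_of_mem_domain u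
  rw [mem_eigenspace_iff] at hu
  set w := biharmonic u
  have hc3 : Continuous fun y => b + prim (extZero w) y :=
    continuous_const.add (continuous_prim (integrable_extZero _))
  have hc2 : Continuous fun x => a + prim (fun y => b + prim (extZero w) y) x :=
    continuous_const.add (continuous_prim_of_continuous hc3)
  set U₃ := fun y => b + prim (extZero w) y with hU3
  set U₂ := fun x => a + prim U₃ x with hU2
  have hc1 := continuous_prim_of_continuous hc2
  have hc0 := continuous_prim_of_continuous hc1
  have hw : w =ᵐ[unitVol] fun x => μ * prim (prim U₂) x := by
    rw [hu]
    filter_upwards [Lp.coeFn_smul μ (u : L2I), h] with x h1 h2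
    rw [h1, Pi.smul_apply, h2, smul_eq_mul]
  refine ⟨prim (prim U₂), prim U₂, U₂, U₃, ⟨hasDerivAt_prim hc1, hasDerivAt_prim hc2,
    fun x => (hasDerivAt_prim hc3 x).const_add a, fun x hx => ?_, hc3, prim_zero _, prim_zero _,
    h0, h1⟩, h⟩
  have hd := (hasDerivAt_prim (continuous_const.mul hc0) x : HasDerivAt
    (prim fun x => μ * prim (prim U₂) x) (μ * prim (prim U₂) x) x).const_add b
  refine hd.congr_of_eventuallyEq ?_
  filter_upwards [Ioo_mem_nhds hx.1 hx.2] with y hy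
  rw [hU3]
  simp only
  rw [prim_extZero_congr hw (Ioo_subset_Icc_self hy)]
  rfl

theorem ae_unitVol_mem_Icc : ∀ᵐ x ∂unitVol, x ∈ Icc (0 : ℝ) 1 := by
  filter_upwards [ae_restrict_mem measurableSet_Ioo] with x hx using Ioo_subset_Icc_self hx

/-- The eigenspaces for positive eigenvalues are at most one-dimensional. -/
theorem exists_smul_eq_of_mem_eigenspace {μ : ℝ} (hμ : 0 < μ) {u v : biharmonic.domain}
    (hu : u ∈ eigenspace μ) (hv : v ∈ eigenspace μ) (hu0 : u ≠ 0) : ∃ c : ℝ, c • u = v := by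
  obtain ⟨k, hk, rfl⟩ : ∃ k : ℝ, 0 < k ∧ μ = k ^ 4 :=
    ⟨μ ^ (1 / 4 : ℝ), by positivity, by
      rw [← Real.rpow_natCast, ← Real.rpow_mul hμ.le]; norm_num⟩
  obtain ⟨U₀, U₁, U₂, U₃, hU, huU⟩ := exists_isClampedSol hu
  obtain ⟨V₀, V₁, V₂, V₃, hV, hvV⟩ := exists_isClampedSol hv
  have hU2 : U₂ 0 ≠ 0 := by
    intro h
    apply hu0
    apply Subtype.ext
    apply Lp.ext
    filter_upwards [huU, ae_unitVol_mem_Icc, Lp.coeFn_zero ℝ 2 unitVol] with x h1 h2 h3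
    rw [h1, hU.eq_zero hk h h2]
    exact h3.symm
  refine ⟨V₂ 0 / U₂ 0, ?_⟩
  apply Subtype.ext
  apply Lp.ext
  rw [Submodule.coe_smul]
  -- These coefficients cancel the second derivative at `0`.
  have h0 := hU.comb hV (V₂ 0) (U₂ 0)
  filter_upwards [huU, hvV, ae_unitVol_mem_Icc, Lp.coeFn_smul (V₂ 0 / U₂ 0) (u : L2I)]
    with x h1 h2 h3 h4
  rw [h4, Pi.smul_apply, h1, h2, smul_eq_mul]
  have := h0.eq_zero hk (by ring) h3
  field_simp
  linarith

theorem green_of_mem_eigenspace {μ : ℝ} {u : biharmonic.domain} (hu : u ∈ eigenspace μ) :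
    μ • green u = (u : L2I) := by
  have := green_biharmonic u
  rwa [mem_eigenspace_iff.1 hu, map_smul] at this

/-- An eigenvector satisfies `‖u‖² = μ ⟨green u, u⟩`, and the Green operator is nonnegative. -/
theorem pos_of_eigenspace_ne_bot {μ : ℝ} (h : eigenspace μ ≠ ⊥) : 0 < μ := by
  obtain ⟨u, hu, hu0⟩ := Submodule.exists_mem_ne_zero_of_ne_bot h
  have h1 := green_of_mem_eigenspace hu
  have h2 : 0 < inner ℝ (u : L2I) u :=
    real_inner_self_pos.2 fun h => hu0 (Subtype.ext h)
  have h3 : inner ℝ (u : L2I) u = μ * inner ℝ (green u) u := by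
    conv_lhs => rw [← h1]
    rw [real_inner_smul_left, h1]
  have h4 : 0 ≤ inner ℝ (green u) (u : L2I) := by
    rw [inner_green]; exact real_inner_self_nonneg
  rw [h3] at h2
  exact pos_of_mul_pos_left h2 h4

theorem finrank_eigenspace {μ : ℝ} (h : eigenspace μ ≠ ⊥) :
    Module.finrank ℝ (eigenspace μ) = 1 := by
  obtain ⟨u, hu, hu0⟩ := Submodule.exists_mem_ne_zero_of_ne_bot h
  refine (finrank_eq_one_iff_of_nonzero' (⟨u, hu⟩ : eigenspace μ) (by simpa using hu0)).2 ?_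
  rintro ⟨v, hv⟩
  obtain ⟨c, hc⟩ := exists_smul_eq_of_mem_eigenspace (pos_of_eigenspace_ne_bot h) hu hv hu0
  exact ⟨c, Subtype.ext hc⟩

/-! ### The eigenbasis -/

theorem exists_unit_eigenvector {μ : ℝ} (h : eigenspace μ ≠ ⊥) :
    ∃ u : biharmonic.domain, u ∈ eigenspace μ ∧ ‖(u : L2I)‖ = 1 := by
  obtain ⟨u, hu, hu0⟩ := Submodule.exists_mem_ne_zero_of_ne_bot h
  have h0 : (u : L2I) ≠ 0 := fun h => hu0 (Subtype.ext h)
  refine ⟨‖(u : L2I)‖⁻¹ • u, Submodule.smul_mem _ _ hu, ?_⟩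
  rw [Submodule.coe_smul, norm_smul, norm_inv, norm_norm, inv_mul_cancel₀ (norm_ne_zero_iff.2 h0)]

theorem green_injective : Function.Injective green := by
  intro u v h
  rw [← biharmonic_green u, ← biharmonic_green v]
  congr 1
  exact Subtype.ext h

theorem exists_mem_eigenspace_of_green {ν : ℝ} {v : L2I} (hv : green v = ν • v) (hν : ν ≠ 0) :
    ∃ u ∈ eigenspace ν⁻¹, (u : L2I) = v := by
  have h1 : green (ν⁻¹ • v) = v := by rw [map_smul, hv, inv_smul_smul₀ hν]
  refine ⟨⟨green (ν⁻¹ • v), green_mem_domain _⟩, ?_, h1⟩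
  rw [mem_eigenspace_iff, biharmonic_green]
  simp only [h1]

/-- Simplicity allows indexing by the eigenvalues themselves. Completeness is the spectral theorem
for the compact symmetric Green operator: by injectivity it has no kernel, and each of its
eigenvalues `ν` comes from `ν⁻¹`. -/
theorem exists_eigenbasis : ∃ b : HilbertBasis {μ : ℝ | eigenspace μ ≠ ⊥} ℝ L2I,
    ∀ μ, green (b μ) = (μ : ℝ)⁻¹ • b μ := by
  choose e he hn using fun μ : {μ : ℝ | eigenspace μ ≠ ⊥} => exists_unit_eigenvector μ.2
  have hg : ∀ μ, green (e μ) = (μ : ℝ)⁻¹ • (e μ : L2I) := by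
    intro μ
    conv_rhs => rw [← green_of_mem_eigenspace (he μ)]
    rw [inv_smul_smul₀ (pos_of_eigenspace_ne_bot μ.2).ne']
  have ho : Orthonormal ℝ fun μ => (e μ : L2I) := by
    refine ⟨hn, fun μ ν hμν => ?_⟩
    have h1 : inner ℝ (green (e μ)) (e ν : L2I) = inner ℝ (e μ : L2I) (green (e ν)) :=
      green_isSymmetric _ _
    rw [hg, hg, real_inner_smul_left, real_inner_smul_right] at h1
    have h2 : ((μ : ℝ)⁻¹ - (ν : ℝ)⁻¹) * inner ℝ (e μ : L2I) (e ν) = 0 := by linarith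
    refine (mul_eq_zero.1 h2).resolve_left fun h3 => hμν ?_
    exact Subtype.ext (inv_injective (sub_eq_zero.1 h3))
  have hs : (Submodule.span ℝ (range fun μ => (e μ : L2I)))ᗮ = ⊥ := by
    rw [eq_bot_iff, ← ContinuousLinearMap.orthogonalComplement_iSup_eigenspaces_eq_bot
      green_isCompactOperator green_isSymmetric]
    refine Submodule.orthogonal_le (iSup_le fun ν v hv => ?_)
    have hv' : green v = ν • v := Module.End.mem_eigenspace_iff.1 hv
    by_cases hv0 : v = 0
    · rw [hv0]; exact zero_mem _
    have hν : ν ≠ 0 := by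
      rintro rfl
      exact hv0 (green_injective (by rw [hv', zero_smul, map_zero]))
    obtain ⟨u, hu, rfl⟩ := exists_mem_eigenspace_of_green hv' hν
    have hu0 : u ≠ 0 := fun h => hv0 (by rw [h]; rfl)
    have hne : eigenspace ν⁻¹ ≠ ⊥ := fun h => hu0 (by rwa [h, Submodule.mem_bot] at hu)
    have he0 : e ⟨ν⁻¹, hne⟩ ≠ 0 := by
      intro h
      have := hn ⟨ν⁻¹, hne⟩
      rw [h] at this
      simp at this
    obtain ⟨c, hc⟩ := exists_smul_eq_of_mem_eigenspace (pos_of_eigenspace_ne_bot hne)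
      (he ⟨ν⁻¹, hne⟩) hu he0
    rw [← hc]
    exact Submodule.smul_mem _ c (Submodule.subset_span ⟨_, rfl⟩)
  refine ⟨HilbertBasis.mkOfOrthogonalEqBot ho hs, fun μ => ?_⟩
  rw [HilbertBasis.coe_mkOfOrthogonalEqBot]
  exact hg μ

/-- The trace was computed in an arbitrary Hilbert basis, so it may be evaluated in the eigenbasis.
-/
theorem hasSum_inv_eigenvalues :
    HasSum (fun μ : {μ : ℝ | eigenspace μ ≠ ⊥} => (μ : ℝ)⁻¹) (1 / 420) := by
  obtain ⟨b, hb⟩ := exists_eigenbasis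
  have h := hasSum_inner_green b
  simp_rw [hb, real_inner_smul_left, real_inner_self_eq_norm_sq, b.orthonormal.1] at h
  simpa using h

/-! ### The spectrum is infinite and discrete. -/

theorem oneL2_notMem_domain : oneL2 ∉ biharmonic.domain := by
  rintro ⟨-, -, U, hU, h1, h2, -⟩
  have h3 : EqOn (fun _ => (1 : ℝ)) U (Icc 0 1) := by
    refine Measure.eqOn_Icc_of_ae_eq (μ := volume) zero_ne_one ?_ continuousOn_const
      hU.continuous.continuousOn
    rw [← restrict_Ioo_eq_restrict_Icc]
    exact (toL2_ae continuous_const).symm.trans h1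
  have := h3 (left_mem_Icc.2 zero_le_one)
  simp [h2] at this

/-- A finite eigenbasis would make `L²(0,1)` finite-dimensional and the injective Green operator
surjective, but its range lies in the domain, which omits the constant `1`. -/
theorem infinite_eigenvalues : {μ : ℝ | eigenspace μ ≠ ⊥}.Infinite := by
  intro hfin
  have := hfin.fintype
  obtain ⟨b, -⟩ := exists_eigenbasis
  have : FiniteDimensional ℝ L2I := b.toOrthonormalBasis.toBasis.finiteDimensional_of_finite
  obtain ⟨w, hw⟩ := (LinearMap.injective_iff_surjective (f := green.toLinearMap)).1
    green_injective oneL2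
  exact oneL2_notMem_domain (hw ▸ green_mem_domain w)

/-- A set of reals all of whose initial segments are finite can be enumerated increasingly. -/
theorem exists_strictMono_range_eq {S : Set ℝ} (hS : S.Infinite)
    (hfin : ∀ M, (S ∩ Iic M).Finite) : ∃ f : ℕ → ℝ, StrictMono f ∧ range f = S := by
  have hIic : ∀ a : S, (Iic a).Finite := by
    intro a
    refine Finite.of_finite_image ((hfin a).subset ?_) Subtype.val_injective.injOn
    rintro _ ⟨x, hx, rfl⟩
    exact ⟨x.2, hx⟩
  -- A locally finite linear order with a least element and no maximum is isomorphic to `ℕ`.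
  let : LocallyFiniteOrder S := LocallyFiniteOrder.ofFiniteIcc fun a b =>
    (hIic b).subset fun x hx => hx.2
  let : SuccOrder S := LinearLocallyFiniteOrder.succOrder S
  let : PredOrder S := LinearLocallyFiniteOrder.predOrder S
  have hI : Infinite S := hS.to_subtype
  obtain ⟨x0⟩ : Nonempty S := inferInstance
  obtain ⟨m, hm, hmin⟩ := (hIic x0).exists_minimal ⟨x0, mem_Iic.2 le_rfl⟩
  let : OrderBot S :=
    { bot := m
      bot_le := fun a => by
        by_contra h
        rw [not_le] at h
        exact h.not_ge (hmin (h.le.trans hm) h.le) }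
  have : NoMaxOrder S := ⟨fun a => by
    by_contra! h
    exact infinite_univ ((hIic a).subset fun x _ => h x)⟩
  let e : S ≃o ℕ := orderIsoNatOfLinearSuccPredArch
  refine ⟨fun n => e.symm n, fun a b h => e.symm.strictMono h, ?_⟩
  rw [show (fun n => (e.symm n : ℝ)) = Subtype.val ∘ e.symm from rfl, range_comp,
    e.symm.surjective.range_eq, image_univ, Subtype.range_coe]

/-- The inverses are summable, so only finitely many of them are at least `1 / M`. -/
theorem finite_eigenvalues_le (M : ℝ) : ({μ : ℝ | eigenspace μ ≠ ⊥} ∩ Iic M).Finite := by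
  have h := hasSum_inv_eigenvalues.summable.tendsto_cofinite_zero
  by_cases hM : 0 < M
  · have h1 := h.eventually_lt_const (inv_pos.2 hM)
    rw [Filter.eventually_cofinite] at h1
    refine (h1.image Subtype.val).subset ?_
    rintro x ⟨hx, hxM⟩
    refine ⟨⟨x, hx⟩, ?_, rfl⟩
    simp only [mem_ofPred_eq, not_lt]
    exact inv_anti₀ (pos_of_eigenspace_ne_bot hx) hxM
  · refine finite_empty.subset ?_
    rintro x ⟨hx, hxM⟩
    exact hM ((pos_of_eigenspace_ne_bot hx).trans_le hxM)

theorem exists_isEigenvalueSeq : ∃ lam : ℕ → ℝ, IsEigenvalueSeq lam := by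
  obtain ⟨f, hf, hr⟩ := exists_strictMono_range_eq infinite_eigenvalues finite_eigenvalues_le
  have hmem : ∀ i, eigenspace (f i) ≠ ⊥ := fun i => hr.subset ⟨i, rfl⟩
  exact ⟨f, hf, hr, fun i => pos_of_eigenspace_ne_bot (hmem i), fun i => finrank_eigenspace (hmem i)⟩

theorem IsEigenvalueSeq.hasSum_inv {lam : ℕ → ℝ} (h : IsEigenvalueSeq lam) :
    HasSum (fun i => (lam i)⁻¹) (1 / 420) := by
  have h1 := hasSum_inv_eigenvalues
  rw [← h.range_eq] at h1
  exact (Equiv.ofInjective lam h.strictMono.injective).hasSum_iff.2 h1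

/-! ### The discrete Green function -/

/-- The polynomial giving the Green function below the diagonal. -/
def greenPoly (x y : ℝ) : ℝ := x ^ 2 * (1 - y) ^ 2 * (3 * y - x - 2 * x * y) / 6

/-- The Green function of the clamped problem, a cubic spline in `x` with a knot at `y`. -/
def greenFun (x y : ℝ) : ℝ := if x ≤ y then greenPoly x y else greenPoly y x

/-- The derivative of the Green function with respect to `x`. -/
def greenDeriv (x y : ℝ) : ℝ :=
  if x ≤ y then (1 - y) ^ 2 * (2 * x * y - x ^ 2 - 2 * x ^ 2 * y) / 2
  else y ^ 2 * (1 - x) * ((1 - x) * (3 - 2 * y) - 2 * (3 * x - y - 2 * x * y)) / 6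

theorem greenFun_of_le {x y : ℝ} (h : x ≤ y) : greenFun x y = greenPoly x y := if_pos h

theorem greenFun_of_ge {x y : ℝ} (h : y ≤ x) : greenFun x y = greenPoly y x := by
  rcases h.eq_or_lt with rfl | h
  · exact if_pos le_rfl
  · exact if_neg h.not_ge

theorem greenDeriv_of_le {x y : ℝ} (h : x ≤ y) :
    greenDeriv x y = (1 - y) ^ 2 * (2 * x * y - x ^ 2 - 2 * x ^ 2 * y) / 2 := if_pos h

/-- The two branches agree at the knot, so the closed inequality suffices; the node at the pole can
then use either formula. -/
theorem greenDeriv_of_ge {x y : ℝ} (h : y ≤ x) : greenDeriv x y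
    = y ^ 2 * (1 - x) * ((1 - x) * (3 - 2 * y) - 2 * (3 * x - y - 2 * x * y)) / 6 := by
  rcases h.eq_or_lt with rfl | h
  · rw [greenDeriv_of_le le_rfl]; ring
  · exact if_neg h.not_ge

theorem inner_greenRoot_eq_greenFun {x y : ℝ} (hx : x ∈ Icc (0 : ℝ) 1) (hy : y ∈ Icc (0 : ℝ) 1) :
    inner ℝ (greenRoot x) (greenRoot y) = greenFun x y := by
  rcases le_total x y with h | h
  · rw [real_inner_comm, inner_greenRoot hx.1 h hy.2, greenFun_of_le h, greenPoly]
  · rw [inner_greenRoot hy.1 h hx.2, greenFun_of_ge h, greenPoly]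

/-- The restriction of a function to the grid. -/
def gridOf (N : ℕ) [NeZero N] (f : ℝ → ℝ) (h0 : f 0 = 0) (h1 : f 1 = 0) : gridSpace N :=
  ⟨fun j => f (j * mesh N), by
    have : (N : ℝ) * mesh N = 1 := mul_one_div_cancel (NeZero.ne _)
    constructor <;> simp [h0, h1, this]⟩

theorem gridSpace_ext {N : ℕ} {u v : gridSpace N}
    (h : ∀ j : Fin (N + 1), 0 < j.val → j.val < N → u.1 j = v.1 j) : u = v := by
  ext j
  by_cases hj : 0 < j.val ∧ j.val < N
  · exact h j hj.1 hj.2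
  · have : j = 0 ∨ j = Fin.last N := by
      rw [Fin.ext_iff, Fin.ext_iff]; simp only [Fin.val_zero, Fin.val_last]; omega
    rcases this with rfl | rfl
    · rw [u.2.1, v.2.1]
    · rw [u.2.2, v.2.2]

theorem stencil_gridOf {N : ℕ} [NeZero N] (a b c : ℝ) {f : ℝ → ℝ} (h0 : f 0 = 0) (h1 : f 1 = 0)
    {j : Fin (N + 1)} (hj0 : 0 < j.val) (hjN : j.val < N) :
    (stencil N a b c (gridOf N f h0 h1)).1 j = a * f (j * mesh N - mesh N) + b * f (j * mesh N)
      + c * f (j * mesh N + mesh N) := by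
  simp only [stencil, LinearMap.coe_mk, AddHom.coe_mk, dif_pos (And.intro hj0 hjN), gridOf]
  rw [Nat.cast_sub (show 1 ≤ j.val from hj0), Nat.cast_add, Nat.cast_one, sub_mul, add_mul, one_mul]

theorem mesh_pos (N : ℕ) [NeZero N] : 0 < mesh N := by
  have : 0 < (N : ℝ) := Nat.cast_pos.2 (NeZero.pos N)
  rw [mesh]; positivity

theorem mesh_mul_mem_Icc {N : ℕ} [NeZero N] {m : ℕ} (hm : m ≤ N) :
    (m : ℝ) * mesh N ∈ Icc (0 : ℝ) 1 := by
  have h1 := mesh_pos N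
  refine ⟨by positivity, ?_⟩
  have : (N : ℝ) * mesh N = 1 := mul_one_div_cancel (NeZero.ne _)
  rw [← this]
  gcongr

/-- The discrete Green function with pole at the `m`-th node. -/
def gridGreen (N : ℕ) [NeZero N] (m : ℕ) (hm : m ≤ N) : gridSpace N :=
  gridOf N (fun x => mesh N * greenFun x (m * mesh N))
    (by rw [greenFun_of_le (mesh_mul_mem_Icc hm).1]; simp [greenPoly])
    (by rw [greenFun_of_ge (mesh_mul_mem_Icc hm).2]; simp [greenPoly])

/-- The values at the nodes of the derivative of the Green function. -/
def gridGreenDeriv (N : ℕ) [NeZero N] (m : ℕ) (hm : m ≤ N) : gridSpace N :=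
  gridOf N (fun x => mesh N * greenDeriv x (m * mesh N))
    (by rw [greenDeriv_of_le (mesh_mul_mem_Icc hm).1]; simp)
    (by rw [greenDeriv_of_ge (mesh_mul_mem_Icc hm).2]; simp)

/-- As the pole is a node, a three-point stencil lies on one side of it or is centred at it, so a
knot never falls inside a mesh cell. -/
theorem node_cases (h : ℝ) (hh : 0 < h) (j m : ℕ) :
    (j * h + h ≤ m * h ∧ j ≠ m) ∨ (j = m) ∨ (m * h ≤ j * h - h ∧ j ≠ m) := by
  rcases lt_trichotomy j m with hlt | heq | hgt
  · left
    have : ((j + 1 : ℕ) : ℝ) ≤ m := Nat.cast_le.2 hlt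
    push_cast at this
    exact ⟨by nlinarith, hlt.ne⟩
  · exact Or.inr (Or.inl heq)
  · right; right
    have : ((m + 1 : ℕ) : ℝ) ≤ j := Nat.cast_le.2 hgt
    push_cast at this
    exact ⟨by nlinarith, hgt.ne'⟩

/-- The relation `σ_x s' = δ_x s` is Simpson's rule for `∫ s'` over two cells. It is exact for
quadratics, and also for the term `(x - y)₊²` with `y` at the midpoint, hence for this spline. -/
theorem hermitian_gridGreen (N : ℕ) [NeZero N] (m : ℕ) (hm : m ≤ N) :
    hermitian N (gridGreen N m hm) = gridGreenDeriv N m hm := by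
  apply simpson_injective N
  rw [simpson_hermitian]
  refine gridSpace_ext fun j hj0 hjN => ?_
  rw [delta, simpson, gridGreenDeriv, stencil_gridOf _ _ _ _ _ hj0 hjN, LinearMap.smul_apply,
    Submodule.coe_smul, Pi.smul_apply, gridGreen, stencil_gridOf _ _ _ _ _ hj0 hjN, smul_eq_mul]
  have hh := mesh_pos N
  set h := mesh N
  set x := (j : ℝ) * h with hx
  set y := (m : ℝ) * h with hy
  have hne := hh.ne'
  rcases node_cases h hh j m with ⟨hc, -⟩ | hc | ⟨hc, -⟩
  · rw [greenFun_of_le (show x - h ≤ y by linarith), greenFun_of_le (show x ≤ y by linarith),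
      greenFun_of_le (show x + h ≤ y by linarith), greenDeriv_of_le (show x - h ≤ y by linarith),
      greenDeriv_of_le (show x ≤ y by linarith), greenDeriv_of_le (show x + h ≤ y by linarith)]
    simp only [greenPoly]
    field_simp
    ring
  · have hxy : y = x := by rw [hx, hy, hc]
    rw [hxy, greenFun_of_le (show x - h ≤ x by linarith), greenFun_of_le (show x ≤ x by linarith),
      greenFun_of_ge (show x ≤ x + h by linarith), greenDeriv_of_le (show x - h ≤ x by linarith),
      greenDeriv_of_le (show x ≤ x by linarith), greenDeriv_of_ge (show x ≤ x + h by linarith)]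
    simp only [greenPoly]
    field_simp
    ring
  · rw [greenFun_of_ge (show y ≤ x - h by linarith), greenFun_of_ge (show y ≤ x by linarith),
      greenFun_of_ge (show y ≤ x + h by linarith), greenDeriv_of_ge (show y ≤ x - h by linarith),
      greenDeriv_of_ge (show y ≤ x by linarith), greenDeriv_of_ge (show y ≤ x + h by linarith)]
    simp only [greenPoly]
    field_simp
    ring

/-- The operator annihilates cubics, and at a knot it returns the jump of the third derivative
divided by `h`. The jump of `G` is `1`, and the factor `h` in `gridGreen` normalizes the result. -/
theorem discreteBiharmonic_gridGreen (N : ℕ) [NeZero N] (m : ℕ) (hm : m ≤ N) (j : Fin (N + 1))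
    (hj0 : 0 < j.val) (hjN : j.val < N) :
    (discreteBiharmonic N (gridGreen N m hm)).1 j = if j.val = m then 1 else 0 := by
  rw [discreteBiharmonic, LinearMap.smul_apply, LinearMap.sub_apply, LinearMap.comp_apply,
    hermitian_gridGreen, Submodule.coe_smul, Pi.smul_apply, Submodule.coe_sub, Pi.sub_apply,
    delta, deltaSq, LinearMap.smul_apply, LinearMap.smul_apply, Submodule.coe_smul, Pi.smul_apply,
    Submodule.coe_smul, Pi.smul_apply, gridGreenDeriv, gridGreen, stencil_gridOf _ _ _ _ _ hj0 hjN,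
    stencil_gridOf _ _ _ _ _ hj0 hjN]
  simp only [smul_eq_mul]
  have hh := mesh_pos N
  set h := mesh N
  set x := (j : ℝ) * h with hx
  set y := (m : ℝ) * h with hy
  have hne := hh.ne'
  rcases node_cases h hh j m with ⟨hc, hjm⟩ | hc | ⟨hc, hjm⟩
  · rw [greenFun_of_le (show x - h ≤ y by linarith), greenFun_of_le (show x ≤ y by linarith),
      greenFun_of_le (show x + h ≤ y by linarith), greenDeriv_of_le (show x - h ≤ y by linarith),
      greenDeriv_of_le (show x ≤ y by linarith), greenDeriv_of_le (show x + h ≤ y by linarith),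
      if_neg hjm]
    simp only [greenPoly]
    field_simp
    ring
  · have hxy : y = x := by rw [hx, hy, hc]
    rw [hxy, greenFun_of_le (show x - h ≤ x by linarith), greenFun_of_le (show x ≤ x by linarith),
      greenFun_of_ge (show x ≤ x + h by linarith), greenDeriv_of_le (show x - h ≤ x by linarith),
      greenDeriv_of_le (show x ≤ x by linarith), greenDeriv_of_ge (show x ≤ x + h by linarith),
      if_pos hc]
    simp only [greenPoly]
    field_simp
    ring
  · rw [greenFun_of_ge (show y ≤ x - h by linarith), greenFun_of_ge (show y ≤ x by linarith),
      greenFun_of_ge (show y ≤ x + h by linarith), greenDeriv_of_ge (show y ≤ x - h by linarith),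
      greenDeriv_of_ge (show y ≤ x by linarith), greenDeriv_of_ge (show y ≤ x + h by linarith),
      if_neg hjm]
    simp only [greenPoly]
    field_simp
    ring

/-! ### Matrices -/

/-- Grid functions are determined by their values at the interior nodes. -/
def gridEquiv (N : ℕ) : gridSpace N ≃ₗ[ℝ] (Fin (N - 1) → ℝ) where
  toFun v i := v.1 ⟨i.val + 1, by omega⟩
  map_add' u v := rfl
  map_smul' c u := rfl
  invFun w := ⟨fun j => if hj : 0 < j.val ∧ j.val < N then w ⟨j.val - 1, by omega⟩ else 0, by
    constructor <;> simp⟩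
  left_inv v := by
    refine gridSpace_ext fun j h0 hN => ?_
    simp only [dif_pos (And.intro h0 hN)]
    exact congrArg v.1 (Fin.ext (by simp only; omega))
  right_inv w := by
    ext i
    have : 0 < i.val + 1 ∧ i.val + 1 < N := by omega
    simp only [dif_pos this, Nat.add_sub_cancel]

/-- The basis of the grid functions given by the interior nodes. -/
def gridBasis (N : ℕ) : Module.Basis (Fin (N - 1)) ℝ (gridSpace N) :=
  Module.Basis.ofEquivFun (gridEquiv N)

/-- The matrix of the discrete biharmonic operator. -/
def biharmonicMatrix (N : ℕ) : Matrix (Fin (N - 1)) (Fin (N - 1)) ℝ :=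
  LinearMap.toMatrix (gridBasis N) (gridBasis N) (discreteBiharmonic N)

/-- The matrix of the discrete Green function. -/
def greenMatrix (N : ℕ) : Matrix (Fin (N - 1)) (Fin (N - 1)) ℝ :=
  mesh N • Matrix.gram ℝ fun i : Fin (N - 1) => greenRoot ((i.val + 1 : ℕ) * mesh N)

theorem greenMatrix_apply (N : ℕ) [NeZero N] (i j : Fin (N - 1)) : greenMatrix N i j
    = (gridBasis N).repr (gridGreen N (j.val + 1) (by omega)) i := by
  have hi := mesh_mul_mem_Icc (N := N) (m := i.val + 1) (by omega)
  have hj := mesh_mul_mem_Icc (N := N) (m := j.val + 1) (by omega)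
  rw [greenMatrix, Matrix.smul_apply, Matrix.gram_apply, inner_greenRoot_eq_greenFun hi hj]
  rfl

theorem biharmonicMatrix_mul_greenMatrix (N : ℕ) [NeZero N] :
    biharmonicMatrix N * greenMatrix N = 1 := by
  ext i j
  have h1 : (biharmonicMatrix N).mulVec
      ((gridBasis N).repr (gridGreen N (j.val + 1) (by omega)))
      = (gridBasis N).repr (discreteBiharmonic N (gridGreen N (j.val + 1) (by omega))) :=
    LinearMap.toMatrix_mulVec_repr _ _ _ _
  have h2 : (biharmonicMatrix N * greenMatrix N) i j
      = (biharmonicMatrix N).mulVec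
        ((gridBasis N).repr (gridGreen N (j.val + 1) (by omega))) i := by
    rw [Matrix.mul_apply]
    simp only [greenMatrix_apply]
    rfl
  rw [h2, h1]
  have h3 := discreteBiharmonic_gridGreen N (j.val + 1) (by omega) ⟨i.val + 1, by omega⟩
    (by simp) (by simp only; omega)
  refine h3.trans ?_
  simp [Matrix.one_apply, Fin.ext_iff]

/-- A Gram matrix is positive semidefinite, and the inverse just found rules out a kernel. -/
theorem posDef_greenMatrix (N : ℕ) [NeZero N] : (greenMatrix N).PosDef := by
  have h : (greenMatrix N).PosSemidef := (Matrix.posSemidef_gram ℝ _).smul (mesh_pos N).le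
  rw [h.posDef_iff_isUnit]
  exact IsUnit.of_mul_eq_one_right _ (biharmonicMatrix_mul_greenMatrix N)

theorem biharmonicMatrix_eq_inv (N : ℕ) [NeZero N] : biharmonicMatrix N = (greenMatrix N)⁻¹ :=
  (Matrix.inv_eq_left_inv (biharmonicMatrix_mul_greenMatrix N)).symm

theorem posDef_biharmonicMatrix (N : ℕ) [NeZero N] : (biharmonicMatrix N).PosDef := by
  rw [biharmonicMatrix_eq_inv]
  exact (posDef_greenMatrix N).inv

theorem charpoly_discreteBiharmonic (N : ℕ) :
    (discreteBiharmonic N).charpoly = (biharmonicMatrix N).charpoly :=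
  (LinearMap.charpoly_toMatrix _ _).symm

theorem exists_isDiscreteEigenvalueSeq (N : ℕ) [NeZero N] :
    ∃ mu : Fin (N - 1) → ℝ, IsDiscreteEigenvalueSeq N mu := by
  have hp := posDef_biharmonicMatrix N
  set ν := hp.1.eigenvalues with hν
  refine ⟨ν ∘ Tuple.sort ν, Tuple.monotone_sort ν, ?_, fun i => hp.eigenvalues_pos _⟩
  rw [charpoly_discreteBiharmonic, hp.1.charpoly_eq]
  exact (Equiv.prod_comp (Tuple.sort ν) fun i => X - C (ν i)).symm

/-! ### Sum of inverse eigenvalues and the discrete trace. -/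

/-- The trace of the inverse of a positive definite matrix from its eigenvalues. -/
theorem sum_inv_eq_trace_inv {n : Type*} [Fintype n] [DecidableEq n] {A B : Matrix n n ℝ}
    (hA : A.PosDef) (hAB : A * B = 1) {mu : n → ℝ} (hmu : A.charpoly = ∏ i, (X - C (mu i))) :
    ∑ i, (mu i)⁻¹ = B.trace := by
  have hν : ∀ i, hA.1.eigenvalues i ≠ 0 := fun i => (hA.eigenvalues_pos i).ne'
  -- Equal characteristic polynomials have equal root multisets, so `mu` is a rearrangement of the
  -- spectral-theorem eigenvalues.
  have h1 : Finset.univ.val.map mu = Finset.univ.val.map hA.1.eigenvalues := by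
    have hr : ∀ f : n → ℝ, (∏ i, (X - C (f i))).roots = Finset.univ.val.map f := fun f => by
      rw [← Polynomial.roots_multiset_prod_X_sub_C (Finset.univ.val.map f), Multiset.map_map]
      rfl
    rw [← hr, ← hr]
    exact congrArg Polynomial.roots (hmu.symm.trans hA.1.charpoly_eq)
  have h2 : ∑ i, (mu i)⁻¹ = ∑ i, (hA.1.eigenvalues i)⁻¹ := by
    have := congrArg (fun s => (s.map fun x : ℝ => x⁻¹).sum) h1
    simpa [Multiset.map_map] using this
  have h3 : B = Unitary.conjStarAlgAut ℝ _ hA.1.eigenvectorUnitary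
      (Matrix.diagonal fun i => (hA.1.eigenvalues i)⁻¹) := by
    have h4 : A * Unitary.conjStarAlgAut ℝ _ hA.1.eigenvectorUnitary
      (Matrix.diagonal fun i => (hA.1.eigenvalues i)⁻¹) = 1 := by
      conv_lhs => lhs; rw [hA.1.spectral_theorem]
      rw [← map_mul, Matrix.diagonal_mul_diagonal]
      simp [mul_inv_cancel₀ (hν _)]
    rw [← Matrix.inv_eq_right_inv hAB, Matrix.inv_eq_right_inv h4]
  rw [h2, h3, Unitary.conjStarAlgAut_apply, Matrix.trace_mul_cycle]
  simp [Matrix.trace]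

/-- Expansion of the second cube and the power-sum formulas for exponents `3` to `6`. -/
theorem sum_cube_mul_cube (a : ℝ) (n : ℕ) :
    ∑ k ∈ Finset.range n, ((k : ℝ) + 1) ^ 3 * (a - (k + 1)) ^ 3
      = a ^ 3 * (n ^ 2 * (n + 1) ^ 2 / 4)
        - 3 * a ^ 2 * (n * (n + 1) * (2 * n + 1) * (3 * n ^ 2 + 3 * n - 1) / 30)
        + 3 * a * (n ^ 2 * (n + 1) ^ 2 * (2 * n ^ 2 + 2 * n - 1) / 12)
        - n * (n + 1) * (2 * n + 1) * (3 * n ^ 4 + 6 * n ^ 3 - 3 * n + 1) / 42 := by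
  induction n with
  | zero => simp
  | succ n ih =>
    rw [Finset.sum_range_succ, ih]
    push_cast
    ring

/-- The diagonal is `h x³(1-x)³/3` at the interior nodes; the power sums with `a = N` and `n = N -
1` evaluate the total. -/
theorem trace_greenMatrix (N : ℕ) [NeZero N] :
    (greenMatrix N).trace = 1 / 420 + mesh N ^ 4 / 180 - mesh N ^ 6 / 126 := by
  have h1 : ∀ i : Fin (N - 1), greenMatrix N i i = mesh N ^ 7 / 3
      * (((i.val : ℝ) + 1) ^ 3 * (N - (i.val + 1)) ^ 3) := by
    intro i
    have hi := mesh_mul_mem_Icc (N := N) (m := i.val + 1) (by omega)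
    have hN : (N : ℝ) ≠ 0 := NeZero.ne _
    rw [greenMatrix, Matrix.smul_apply, Matrix.gram_apply, inner_greenRoot_eq_greenFun hi hi,
      greenFun_of_le le_rfl, greenPoly, mesh, smul_eq_mul]
    push_cast
    field_simp
    ring
  rw [Matrix.trace]
  simp only [Matrix.diag_apply, h1]
  rw [← Finset.mul_sum, Fin.sum_univ_eq_sum_range
    (fun k => ((k : ℝ) + 1) ^ 3 * ((N : ℝ) - (k + 1)) ^ 3) (N - 1), sum_cube_mul_cube]
  obtain ⟨n, hn⟩ : ∃ n, N = n + 1 := ⟨N - 1, (Nat.succ_pred_eq_of_ne_zero (NeZero.ne N)).symm⟩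
  rw [hn, Nat.add_sub_cancel, mesh]
  have : ((n : ℝ) + 1) ≠ 0 := by positivity
  push_cast
  field_simp
  ring

theorem IsDiscreteEigenvalueSeq.sum_inv {N : ℕ} [NeZero N] {mu : Fin (N - 1) → ℝ}
    (h : IsDiscreteEigenvalueSeq N mu) :
    ∑ i, (mu i)⁻¹ = 1 / 420 + mesh N ^ 4 / 180 - mesh N ^ 6 / 126 := by
  rw [← trace_greenMatrix]
  exact sum_inv_eq_trace_inv (posDef_biharmonicMatrix N) (biharmonicMatrix_mul_greenMatrix N)
    ((charpoly_discreteBiharmonic N).symm.trans h.charpoly_eq)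

end SplineEigen

end

/-! ### The final estimate. -/

theorem mainTheorem11 :
    (∃ lam : ℕ → ℝ, SplineEigen.IsEigenvalueSeq lam) ∧
    (∀ N : ℕ, 1 ≤ N → ∃ mu : Fin (N - 1) → ℝ, SplineEigen.IsDiscreteEigenvalueSeq N mu) ∧
    ∃ C : ℝ, 0 < C ∧
      ∀ lam : ℕ → ℝ, SplineEigen.IsEigenvalueSeq lam →
        HasSum (fun i : ℕ => (lam i)⁻¹) (1 / 420) ∧
        ∀ N : ℕ, 1 ≤ N →
          ∀ mu : Fin (N - 1) → ℝ, SplineEigen.IsDiscreteEigenvalueSeq N mu →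
            (∑ i, (mu i)⁻¹) = 1 / 420 + SplineEigen.mesh N ^ 4 / 180 - SplineEigen.mesh N ^ 6 / 126 ∧
            |(∑' i : ℕ, (lam i)⁻¹) - (∑ i, (mu i)⁻¹)| ≤ C * SplineEigen.mesh N ^ 4 := by
  -- `C = 1` is enough: the difference is `h⁶/126 - h⁴/180` and `h⁶ ≤ h⁴`.
  refine ⟨SplineEigen.exists_isEigenvalueSeq, fun N hN => ?_, 1, one_pos, fun lam hlam =>
    ⟨hlam.hasSum_inv, fun N hN mu hmu => ?_⟩⟩
  · have : NeZero N := ⟨by omega⟩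
    exact SplineEigen.exists_isDiscreteEigenvalueSeq N
  · have : NeZero N := ⟨by omega⟩
    refine ⟨hmu.sum_inv, ?_⟩
    rw [hlam.hasSum_inv.tsum_eq, hmu.sum_inv]
    have h0 := SplineEigen.mesh_pos N
    have h1 : SplineEigen.mesh N ≤ 1 := by
      have := (SplineEigen.mesh_mul_mem_Icc (N := N) (m := 1) hN).2
      simpa using this
    have h2 : SplineEigen.mesh N ^ 6 ≤ SplineEigen.mesh N ^ 4 :=
      pow_le_pow_of_le_one h0.le h1 (by norm_num)
    have h4 : 0 < SplineEigen.mesh N ^ 4 := by positivity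
    have h6 : 0 < SplineEigen.mesh N ^ 6 := by positivity
    rw [abs_le]
    constructor <;> linarith
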